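/- **Terminology.** A *bicategory* is here a category $\mathbb C$ with two classes of morphisms $\mathcal E,\mathcal M$. It is *orean* when $(\mathcal E,\mathcal M)$ is a proper factorization system (both classes contain the isomorphisms and are closed under composition, $\mathcal E$ consists of epimorphisms and $\mathcal M$ of monomorphisms, every morphism is some $e\in\mathcal E$ followed by some $m\in\mathcal M$, and $\mathcal E$ is orthogonal to $\mathcal M$), the posets of $\mathcal E$-quotients and of $\mathcal M$-subobjects of each object are bounded lattices, and pushouts of morphisms in $\mathcal E$ and pullbacks of morphisms in $\mathcal M$ along arbitrary morphisms exist. It is *balanced* when every morphism of $\mathbb C$ that is both a monomorphism and an epimorphism is an isomorphism. A *form* over $\mathbb C$ is a faithful functor $F\colon\mathbb B\to\mathbb C$ such that the only isomorphisms mapped to identities are identities. The *clusters* in an object $X$ are the objects of $\mathbb B$ over $X$; for $f\colon X\to Y$ and clusters $A$ in $X$, $B$ in $Y$, write $B\ge_f A$ if some morphism $A\to B$ lies over $f$. The clusters in $X$ are partially ordered by $\ge_{1_X}$. The form is *orean* if the posets of clusters are bounded lattices; $C\ge_{gf}A$ implies $C\ge_g B\ge_f A$ for some $B$; and for each $f\colon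 X\to Y$ there exist direct images $f\cdot S=\min\{T\mid T\ge_f S\}$ and inverse images $T\cdot f=\max\{S\mid T\ge_f S\}$. Put $\operatorname{Im} f=f\cdot\top$ and $\operatorname{Ker} f=\bot\cdot f$. A cluster is *conormal* if it is the image of a morphism and *normal* if it is the kernel of a morphism. An *embedding* of a cluster $S$ in $X$ is a morphism into $X$ with image $S$ through which every morphism into $X$ with image $\le S$ factors uniquely; a *quotient* of $S$ is, dually, a morphism from $X$ with kernel $S$ through which every morphism from $X$ with kernel $\ge S$ factors uniquely. An orean form is *noetherian* if - $(f\cdot S)\cdot f=S\vee\operatorname{Ker} f$ and $f\cdot(T\cdot f)=T\wedge\operatorname{Im} f$ for all $f\colon X\to Y$ and all clusters $S$ in $X$, $T$ in $Y$; - every morphism $f$ is a quotient of $\operatorname{Ker} f$ followed by an embedding of $\operatorname{Im} f$; - the join of two normal clusters is normal and the meet of two conormal clusters is conormal. An *operator* $F\to G$ between forms over $\mathbb C$ sends $F$-clusters in $X$ to $G$-clusters in $X$, for each $X$, and preserves all relations $\ge_f$. An operator between orean forms is *conormal* if it preserves images of morphisms, *normal* if it preserves kernels of morphisms, and *binormal*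 if it does both. An *exact meet decomposition* of an orean form $F$ consists of idempotent operators $\kappa_s,\kappa_e\colon F\to F$ with $S=\kappa_s S\wedge\kappa_e S$ for every cluster $S$, such that, for the subforms $F_s$, $F_e$ of clusters fixed by $\kappa_s$, $\kappa_e$: both are orean; every cluster of $F_s$ is conormal in $F_s$ and every cluster of $F_e$ is normal in $F_e$; the operators $F\to F_s$ and $F\to F_e$ given by $\kappa_s$ and $\kappa_e$ are binormal; there exist a conormal operator $F_s\to F_e$ and a normal operator $F_e\to F_s$; the inclusion $F_s\to F$ is conormal and the inclusion $F_e\to F$ is normal. An *emd-noetherian form* is a noetherian form that has an exact meet decomposition. **Theorem.** Let $\mathbb C$ and $\mathbb C'$ be (the underlying categories of) balanced orean bicategories, where $\mathbb C$ has finite colimits, a terminal object and pullbacks. Suppose that there is a faithful functor $T\colon\mathbb C\to\mathbb C'$ which preserves finite colimits, the terminal object, monomorphisms, and pullbacks of epimorphisms along arbitrary morphisms. If $\mathbb C'$ has an emd-noetherian form, then $\mathbb C$ has an emd-noetherian form. -/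

import Mathlib

open CategoryTheory CategoryTheory.Limits

namespace FormTheory

/-! ## Cluster systems -/

/-- A cluster system over a category: clusters in each object, and for each morphism `f : X ⟶ Y`
a relation `rel f A B` (read `B ≥_f A`) between clusters `A` in `X` and clusters `B` in `Y`. -/
structure ClusterSystem.{w, v, u} (C : Type u) [Category.{v} C] where
  /-- the clusters in an object -/
  Cluster : C → Type w
  /-- `rel f A B` means `B ≥_f A` -/
  rel : ∀ {X Y : C}, (X ⟶ Y) → Cluster X → Cluster Y → Prop
  rel_id : ∀ {X : C} (S : Cluster X), rel (𝟙 X) S S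
  rel_comp : ∀ {X Y Z : C} (f : X ⟶ Y) (g : Y ⟶ Z) (A : Cluster X) (B : Cluster Y)
    (D : Cluster Z), rel f A B → rel g B D → rel (f ≫ g) A D
  rel_antisymm : ∀ {X : C} (S T : Cluster X), rel (𝟙 X) S T → rel (𝟙 X) T S → S = T

namespace ClusterSystem

universe w w' v u

variable {C : Type u} [Category.{v} C]

/-- The clusters in an object are partially ordered by the relation of the identity morphism. -/
instance (P : ClusterSystem.{w} C) (X : C) : PartialOrder (P.Cluster X) where
  le S T := P.rel (𝟙 X) S T
  le_refl S := P.rel_id S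
  le_trans A B D h h' := by simpa using P.rel_comp (𝟙 X) (𝟙 X) A B D h h'
  le_antisymm S T := P.rel_antisymm S T

variable (P : ClusterSystem.{w} C)

/-- `T = f · S`: `T` is the direct image of `S` along `f`. -/
def IsDirectImage {X Y : C} (f : X ⟶ Y) (S : P.Cluster X) (T : P.Cluster Y) : Prop :=
  IsLeast {T' : P.Cluster Y | P.rel f S T'} T

/-- `S = T · f`: `S` is the inverse image of `T` along `f`. -/
def IsInverseImage {X Y : C} (f : X ⟶ Y) (T : P.Cluster Y) (S : P.Cluster X) : Prop :=
  IsGreatest {S' : P.Cluster X | P.rel f S' T} S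

/-- The axioms of an orean form. -/
structure IsOrean : Prop where
  exists_bot : ∀ X : C, ∃ S : P.Cluster X, IsBot S
  exists_top : ∀ X : C, ∃ S : P.Cluster X, IsTop S
  exists_sup : ∀ {X : C} (A B : P.Cluster X), ∃ S, IsLUB {A, B} S
  exists_inf : ∀ {X : C} (A B : P.Cluster X), ∃ S, IsGLB {A, B} S
  exists_between : ∀ {X Y Z : C} (f : X ⟶ Y) (g : Y ⟶ Z) (A : P.Cluster X) (D : P.Cluster Z),
    P.rel (f ≫ g) A D → ∃ B : P.Cluster Y, P.rel f A B ∧ P.rel g B D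
  exists_directImage : ∀ {X Y : C} (f : X ⟶ Y) (S : P.Cluster X), ∃ T, P.IsDirectImage f S T
  exists_inverseImage : ∀ {X Y : C} (f : X ⟶ Y) (T : P.Cluster Y), ∃ S, P.IsInverseImage f T S

/-- `S = Im f`: `S` is the direct image of the top cluster. -/
def IsImage {X Y : C} (f : X ⟶ Y) (S : P.Cluster Y) : Prop :=
  ∃ t : P.Cluster X, IsTop t ∧ P.IsDirectImage f t S

/-- `S = Ker f`: `S` is the inverse image of the bottom cluster. -/
def IsKernel {X Y : C} (f : X ⟶ Y) (S : P.Cluster X) : Prop :=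
  ∃ b : P.Cluster Y, IsBot b ∧ P.IsInverseImage f b S

/-- A cluster is conormal when it is the image of some morphism. -/
def IsConormal {X : C} (S : P.Cluster X) : Prop :=
  ∃ (W : C) (f : W ⟶ X), P.IsImage f S

/-- A cluster is normal when it is the kernel of some morphism. -/
def IsNormal {X : C} (S : P.Cluster X) : Prop :=
  ∃ (Y : C) (g : X ⟶ Y), P.IsKernel g S

/-- `m` is an embedding of the cluster `S`. -/
def IsEmbedding {W X : C} (m : W ⟶ X) (S : P.Cluster X) : Prop :=
  P.IsImage m S ∧ ∀ (W' : C) (m' : W' ⟶ X) (S' : P.Cluster X), P.IsImage m' S' → S' ≤ S →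
    ∃! g : W' ⟶ W, g ≫ m = m'

/-- `e` is a quotient of the cluster `S`. -/
def IsQuotient {X Y : C} (e : X ⟶ Y) (S : P.Cluster X) : Prop :=
  P.IsKernel e S ∧ ∀ (Y' : C) (e' : X ⟶ Y') (S' : P.Cluster X), P.IsKernel e' S' → S ≤ S' →
    ∃! g : Y ⟶ Y', e ≫ g = e'

/-- The axioms of a noetherian form. -/
structure IsNoetherian : Prop where
  isOrean : P.IsOrean
  /-- `(f · S) · f = S ∨ Ker f` -/
  inverse_direct : ∀ {X Y : C} (f : X ⟶ Y) (S : P.Cluster X) (T : P.Cluster Y)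
    (U K : P.Cluster X), P.IsDirectImage f S T → P.IsInverseImage f T U → P.IsKernel f K →
    IsLUB {S, K} U
  /-- `f · (T · f) = T ∧ Im f` -/
  direct_inverse : ∀ {X Y : C} (f : X ⟶ Y) (T : P.Cluster Y) (S : P.Cluster X)
    (U I : P.Cluster Y), P.IsInverseImage f T S → P.IsDirectImage f S U → P.IsImage f I →
    IsGLB {T, I} U
  /-- every morphism is a quotient of its kernel followed by an embedding of its image -/
  factorization : ∀ {X Y : C} (f : X ⟶ Y), ∃ (W : C) (e : X ⟶ W) (m : W ⟶ Y)
    (K : P.Cluster X) (I : P.Cluster Y), P.IsKernel f K ∧ P.IsImage f I ∧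
    P.IsQuotient e K ∧ P.IsEmbedding m I ∧ e ≫ m = f
  normal_sup : ∀ {X : C} (A B S : P.Cluster X), P.IsNormal A → P.IsNormal B →
    IsLUB {A, B} S → P.IsNormal S
  conormal_inf : ∀ {X : C} (A B S : P.Cluster X), P.IsConormal A → P.IsConormal B →
    IsGLB {A, B} S → P.IsConormal S

/-! ## Operators and decompositions -/

/-- An operator between cluster systems over the same category. -/
structure Operator (P : ClusterSystem.{w} C) (Q : ClusterSystem.{w'} C) where
  /-- the action on clusters -/
  toFun : ∀ {X : C}, P.Cluster X → Q.Cluster X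
  monotone : ∀ {X Y : C} (f : X ⟶ Y) (A : P.Cluster X) (B : P.Cluster Y),
    P.rel f A B → Q.rel f (toFun A) (toFun B)

namespace Operator

variable {P} {Q : ClusterSystem.{w'} C}

/-- `τ (Im f) = Im f` -/
def IsConormal (τ : Operator P Q) : Prop :=
  ∀ {X Y : C} (f : X ⟶ Y) (S : P.Cluster Y), P.IsImage f S → Q.IsImage f (τ.toFun S)

/-- `τ (Ker f) = Ker f` -/
def IsNormal (τ : Operator P Q) : Prop :=
  ∀ {X Y : C} (f : X ⟶ Y) (S : P.Cluster X), P.IsKernel f S → Q.IsKernel f (τ.toFun S)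

/-- An operator that is both conormal and normal. -/
def IsBinormal (τ : Operator P Q) : Prop := τ.IsConormal ∧ τ.IsNormal

/-- `κ ∘ κ = κ` -/
def IsIdempotent (κ : Operator P P) : Prop :=
  ∀ {X : C} (S : P.Cluster X), κ.toFun (κ.toFun S) = κ.toFun S

/-- The subform of clusters that are closed relative to `κ`. -/
def closed (κ : Operator P P) : ClusterSystem.{w} C where
  Cluster X := {S : P.Cluster X // κ.toFun S = S}
  rel f A B := P.rel f A.1 B.1
  rel_id S := P.rel_id S.1
  rel_comp f g A B D := P.rel_comp f g A.1 B.1 D.1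
  rel_antisymm S T h h' := Subtype.ext (P.rel_antisymm S.1 T.1 h h')

/-- The subform inclusion of the closed clusters. -/
def inclusion (κ : Operator P P) : Operator κ.closed P where
  toFun S := S.1
  monotone _ _ _ h := h

/-- The restriction of an idempotent operator to an operator into its closed clusters. -/
def projection (κ : Operator P P) (h : κ.IsIdempotent) : Operator P κ.closed where
  toFun S := ⟨κ.toFun S, h S⟩
  monotone := κ.monotone

end Operator

/-- `(κs, κe)` is a meet decomposition: a decomposition `S = κs S ∧ κe S` of every cluster, where
the closed clusters of `κs` form a conormal orean form and those of `κe` a normal orean form. -/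
structure IsMeetDecomposition (κs κe : Operator P P) : Prop where
  idem_s : κs.IsIdempotent
  idem_e : κe.IsIdempotent
  orean_s : κs.closed.IsOrean
  conormal_s : ∀ {X : C} (S : κs.closed.Cluster X), κs.closed.IsConormal S
  orean_e : κe.closed.IsOrean
  normal_e : ∀ {X : C} (S : κe.closed.Cluster X), κe.closed.IsNormal S
  meet : ∀ {X : C} (S : P.Cluster X), IsGLB {κs.toFun S, κe.toFun S} S

/-- `(κs, κe)` is an exact meet decomposition: the decomposition projections are binormal, the
pair of subforms of closed clusters is a semiexact pair, and the subform inclusions are conormal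
and normal, respectively. -/
structure IsExactMeetDecomposition (κs κe : Operator P P) : Prop
    extends P.IsMeetDecomposition κs κe where
  binormal_s : (κs.projection idem_s).IsBinormal
  binormal_e : (κe.projection idem_e).IsBinormal
  exists_conormal : ∃ α : Operator κs.closed κe.closed, α.IsConormal
  exists_normal : ∃ β : Operator κe.closed κs.closed, β.IsNormal
  inclusion_s : κs.inclusion.IsConormal
  inclusion_e : κe.inclusion.IsNormal

/-- A noetherian form admitting an exact meet decomposition. -/
structure IsEmdNoetherian : Prop where
  isNoetherian : P.IsNoetherian
  exists_decomposition : ∃ κs κe : Operator P P, P.IsExactMeetDecomposition κs κe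

end ClusterSystem

/-! ## Forms -/

section Forms

universe v₁ u₁ v u

variable {B : Type u₁} [Category.{v₁} B] {C : Type u} [Category.{v} C]

/-- A form is a faithful amnestic functor: the only isomorphisms which it maps to identity
morphisms are the identity morphisms. -/
structure IsForm (F : B ⥤ C) : Prop where
  faithful : F.Faithful
  amnestic : ∀ ⦃A A' : B⦄ (φ : A ≅ A'), F.IsHomLift (𝟙 (F.obj A)) φ.hom →
    ∃ h : A = A', φ.hom = eqToHom h

/-- The canonical presentation of a form: clusters in `X` are the objects `A` with `F.obj A = X`,
and `A' ≥_f A` means that some morphism `A ⟶ A'` is mapped to `f`. -/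
def IsForm.clusters {F : B ⥤ C} (hF : IsForm F) : ClusterSystem.{u₁} C where
  Cluster X := F.Fiber X
  rel f A A' := ∃ φ : A.1 ⟶ A'.1, F.IsHomLift f φ
  rel_id S := ⟨𝟙 S.1, IsHomLift.id S.2⟩
  rel_comp f g _ _ _ := by
    rintro ⟨φ, hφ⟩ ⟨ψ, hψ⟩
    exact ⟨φ ≫ ψ, inferInstance⟩
  rel_antisymm := by
    rintro X ⟨S, rfl⟩ ⟨T, hT⟩ ⟨φ, hφ⟩ ⟨ψ, hψ⟩
    dsimp at φ ψ hφ hψ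
    have := hF.faithful
    have key : ∀ {A : B} (χ : A ⟶ A) {Y : C}, F.IsHomLift (𝟙 Y) χ → χ = 𝟙 A := by
      intro A χ Y h
      apply F.map_injective
      rw [IsHomLift.fac' F (𝟙 Y) χ]
      simp
    obtain ⟨h, -⟩ := hF.amnestic
      { hom := φ
        inv := ψ
        hom_inv_id := key (φ ≫ ψ) (Y := F.obj S) inferInstance
        inv_hom_id := key (ψ ≫ φ) (Y := F.obj S) inferInstance } hφ
    exact Subtype.ext h

/-- The category `C` has an emd-noetherian form, i.e. a noetherian form admitting an exact meet
decomposition. The universe `z` bounds the size of the sets of clusters in the objects of `C`. -/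
def HasEmdNoetherianForm.{z, y, x} (C : Type x) [Category.{y} C] : Prop :=
  ∃ (B : Type (max x z)) (_ : Category.{y} B) (F : B ⥤ C) (hF : IsForm F),
    (∀ X : C, Small.{z} (F.Fiber X)) ∧ hF.clusters.IsEmdNoetherian

end Forms

/-! ## Orean bicategories -/

section Bicategories

universe v u

variable {C : Type u} [Category.{v} C]

/-- `(E, M)` is a proper factorization system. -/
structure IsProperFactorizationSystem (E M : MorphismProperty C) : Prop where
  iso_right : MorphismProperty.isomorphisms C ≤ E
  iso_left : MorphismProperty.isomorphisms C ≤ M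
  comp_right : ∀ {X Y Z : C} (f : X ⟶ Y) (g : Y ⟶ Z), E f → E g → E (f ≫ g)
  comp_left : ∀ {X Y Z : C} (f : X ⟶ Y) (g : Y ⟶ Z), M f → M g → M (f ≫ g)
  epi_right : E ≤ MorphismProperty.epimorphisms C
  mono_left : M ≤ MorphismProperty.monomorphisms C
  factorization : ∀ {X Y : C} (f : X ⟶ Y),
    ∃ (W : C) (e : X ⟶ W) (m : W ⟶ Y), E e ∧ M m ∧ e ≫ m = f
  diagonal : ∀ {X Y Z W : C} (e : X ⟶ Y) (m : Z ⟶ W) (f : X ⟶ Z) (g : Y ⟶ W), E e → M m →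
    e ≫ g = f ≫ m → ∃! d : Y ⟶ Z, e ≫ d = f ∧ d ≫ m = g

/-- Morphisms in `M` with codomain `X`. -/
structure SubobjectRep (M : MorphismProperty C) (X : C) where
  /-- the domain -/
  dom : C
  /-- the morphism -/
  hom : dom ⟶ X
  mem : M hom

/-- Representatives of `M`-subobjects, preordered by factorization. The poset of `M`-subobjects is
the quotient of this preorder by equivalence; meets and joins there are the same as greatest lower
and least upper bounds here. -/
instance (M : MorphismProperty C) (X : C) : Preorder (SubobjectRep M X) where
  le a b := ∃ t : a.dom ⟶ b.dom, t ≫ b.hom = a.hom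
  le_refl a := ⟨𝟙 _, by simp⟩
  le_trans := by
    rintro a b c ⟨s, hs⟩ ⟨t, ht⟩
    exact ⟨s ≫ t, by rw [Category.assoc, ht, hs]⟩

/-- Morphisms in `E` with domain `X`. -/
structure QuotientRep (E : MorphismProperty C) (X : C) where
  /-- the codomain -/
  cod : C
  /-- the morphism -/
  hom : X ⟶ cod
  mem : E hom

/-- Representatives of `E`-quotients, preordered by factorization (the identity is smallest). -/
instance (E : MorphismProperty C) (X : C) : Preorder (QuotientRep E X) where
  le a b := ∃ t : a.cod ⟶ b.cod, a.hom ≫ t = b.hom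
  le_refl a := ⟨𝟙 _, by simp⟩
  le_trans := by
    rintro a b c ⟨s, hs⟩ ⟨t, ht⟩
    exact ⟨s ≫ t, by rw [← Category.assoc, hs, ht]⟩

/-- A preorder whose quotient poset is a bounded lattice. -/
structure IsBoundedLattice (α : Type*) [Preorder α] : Prop where
  exists_bot : ∃ a : α, IsBot a
  exists_top : ∃ a : α, IsTop a
  exists_sup : ∀ a b : α, ∃ c, IsLUB {a, b} c
  exists_inf : ∀ a b : α, ∃ c, IsGLB {a, b} c

/-- `(C, E, M)` is an orean bicategory; `E` consists of the right and `M` of the left morphisms. -/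
structure IsOreanBicategory (E M : MorphismProperty C) : Prop where
  isProperFactorizationSystem : IsProperFactorizationSystem E M
  lattice_quotients : ∀ X : C, IsBoundedLattice (QuotientRep E X)
  lattice_subobjects : ∀ X : C, IsBoundedLattice (SubobjectRep M X)
  hasPushout : ∀ {X Y Z : C} (e : X ⟶ Y) (f : X ⟶ Z), E e → HasPushout e f
  hasPullback : ∀ {X Y Z : C} (m : X ⟶ Z) (f : Y ⟶ Z), M m → HasPullback m f

/-- An orean bicategory is balanced when its underlying category is: every morphism that is both a
monomorphism and an epimorphism is an isomorphism. -/
structure IsBalancedOreanBicategory (E M : MorphismProperty C) : Prop where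
  isOrean : IsOreanBicategory E M
  balanced : Balanced C

end Bicategories

end FormTheory

universe w v₁ v₂ u₁ u₂

set_option linter.unusedSectionVars false

universe w' v u

/-! The form on `C` is built from subquotients of `X`: a monomorphism `ι` from `A` to `X` with a
morphism `π` from `A` to an object `Q` that is a quotient of the initial object (`Subinitial`). Such
a pair is sent to the cluster `Tι · Ker Tπ` in `T.obj X` of the given form on `C'` (`toCluster`),
and the new form consists of the clusters so obtained.

The crux is that this assignment reflects the relations `≥_f` (`rel_toCluster_iff`). Applying `κs`
to `Tι · Ker Tπ` recovers `Im Tι`, because `κs` turns the kernel of a morphism into a subinitial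
object into the top cluster (`s_dir_ker`). A relation between clusters thus yields a factorization
in `C'` of subobjects and then one of quotients. Both come from `C`, since `T` is faithful,
preserves finite colimits and monomorphisms, and `C` is balanced (`exists_comp_eq_of_map_mono`,
`exists_comp_eq_of_map_epi`).

Direct images of subquotients are computed by pushouts, which `T` preserves, and inverse images
along epimorphisms by pullbacks, which `T` preserves as well. So the noetherian laws for
epimorphisms pass from `C'` to `C` (`isNoetherian_of_functor`); for monomorphisms they hold
automatically.

For the exact meet decomposition, `κs` replaces `Q` by the terminal object, which is itself
subinitial, and `κe` takes the kernel of the pushout of `π` along `ι`. Every subquotient is the meet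
of the two because pushing out along a monomorphism keeps `Q` a subobject (`mono_of_isPushout`);
this is where the decomposition in `C'` is used again. -/

namespace FormTheory

/-! ### Calculus of direct and inverse images in an orean cluster system. -/

namespace ClusterSystem

variable {C : Type u} [Category.{v} C] {P : ClusterSystem.{w} C}

theorem rel_of_rel_of_le {X Y : C} {f : X ⟶ Y} {S : P.Cluster X} {T T' : P.Cluster Y}
    (h : P.rel f S T) (h' : T ≤ T') : P.rel f S T' := by
  simpa using P.rel_comp f (𝟙 Y) S T T' h h'

theorem rel_of_le_of_rel {X Y : C} {f : X ⟶ Y} {S S' : P.Cluster X} {T : P.Cluster Y}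
    (h' : S ≤ S') (h : P.rel f S' T) : P.rel f S T := by
  simpa using P.rel_comp (𝟙 X) f S S' T h' h

namespace IsOrean

variable (h : P.IsOrean)

/-- The direct image `f · S`. -/
noncomputable def dir {X Y : C} (f : X ⟶ Y) (S : P.Cluster X) : P.Cluster Y :=
  (h.exists_directImage f S).choose

/-- The inverse image `T · f`. -/
noncomputable def inv {X Y : C} (f : X ⟶ Y) (T : P.Cluster Y) : P.Cluster X :=
  (h.exists_inverseImage f T).choose

/-- The smallest cluster. -/
noncomputable def bot (X : C) : P.Cluster X := (h.exists_bot X).choose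

/-- The largest cluster. -/
noncomputable def top (X : C) : P.Cluster X := (h.exists_top X).choose

/-- The image of a morphism. -/
noncomputable def im {X Y : C} (f : X ⟶ Y) : P.Cluster Y := h.dir f (h.top X)

/-- The kernel of a morphism. -/
noncomputable def ker {X Y : C} (f : X ⟶ Y) : P.Cluster X := h.inv f (h.bot Y)

theorem isDirectImage_dir {X Y : C} (f : X ⟶ Y) (S : P.Cluster X) :
    P.IsDirectImage f S (h.dir f S) := (h.exists_directImage f S).choose_spec

theorem isInverseImage_inv {X Y : C} (f : X ⟶ Y) (T : P.Cluster Y) :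
    P.IsInverseImage f T (h.inv f T) := (h.exists_inverseImage f T).choose_spec

theorem bot_le {X : C} (S : P.Cluster X) : h.bot X ≤ S := (h.exists_bot X).choose_spec S

theorem le_top {X : C} (S : P.Cluster X) : S ≤ h.top X := (h.exists_top X).choose_spec S

theorem isDirectImage_iff {X Y : C} {f : X ⟶ Y} {S : P.Cluster X} {T : P.Cluster Y} :
    P.IsDirectImage f S T ↔ T = h.dir f S :=
  ⟨fun hT => hT.unique (h.isDirectImage_dir f S), fun hT => hT ▸ h.isDirectImage_dir f S⟩

theorem isInverseImage_iff {X Y : C} {f : X ⟶ Y} {S : P.Cluster X} {T : P.Cluster Y} :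
    P.IsInverseImage f T S ↔ S = h.inv f T :=
  ⟨fun hS => hS.unique (h.isInverseImage_inv f T), fun hS => hS ▸ h.isInverseImage_inv f T⟩

theorem isTop_iff {X : C} {S : P.Cluster X} : IsTop S ↔ S = h.top X :=
  ⟨fun hS => le_antisymm (h.le_top S) (hS _), fun hS => hS ▸ h.le_top⟩

theorem isBot_iff {X : C} {S : P.Cluster X} : IsBot S ↔ S = h.bot X :=
  ⟨fun hS => le_antisymm (hS _) (h.bot_le S), fun hS => hS ▸ h.bot_le⟩

theorem isImage_iff {X Y : C} {f : X ⟶ Y} {S : P.Cluster Y} : P.IsImage f S ↔ S = h.im f := by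
  constructor
  · rintro ⟨t, ht, hS⟩
    rw [h.isTop_iff] at ht
    subst ht
    exact h.isDirectImage_iff.1 hS
  · rintro rfl
    exact ⟨h.top X, h.le_top, h.isDirectImage_dir f _⟩

theorem isKernel_iff {X Y : C} {f : X ⟶ Y} {S : P.Cluster X} : P.IsKernel f S ↔ S = h.ker f := by
  constructor
  · rintro ⟨t, ht, hS⟩
    rw [h.isBot_iff] at ht
    subst ht
    exact h.isInverseImage_iff.1 hS
  · rintro rfl
    exact ⟨h.bot Y, h.bot_le, h.isInverseImage_inv f _⟩

theorem rel_dir {X Y : C} (f : X ⟶ Y) (S : P.Cluster X) : P.rel f S (h.dir f S) :=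
  (h.isDirectImage_dir f S).1

theorem rel_inv {X Y : C} (f : X ⟶ Y) (T : P.Cluster Y) : P.rel f (h.inv f T) T :=
  (h.isInverseImage_inv f T).1

theorem dir_le_iff {X Y : C} {f : X ⟶ Y} {S : P.Cluster X} {T : P.Cluster Y} :
    h.dir f S ≤ T ↔ P.rel f S T :=
  ⟨fun hT => rel_of_rel_of_le (h.rel_dir f S) hT, fun hT => (h.isDirectImage_dir f S).2 hT⟩

theorem le_inv_iff {X Y : C} {f : X ⟶ Y} {S : P.Cluster X} {T : P.Cluster Y} :
    S ≤ h.inv f T ↔ P.rel f S T :=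
  ⟨fun hT => rel_of_le_of_rel hT (h.rel_inv f T), fun hT => (h.isInverseImage_inv f T).2 hT⟩

theorem dir_mono {X Y : C} (f : X ⟶ Y) {S S' : P.Cluster X} (hS : S ≤ S') :
    h.dir f S ≤ h.dir f S' :=
  h.dir_le_iff.2 (rel_of_le_of_rel hS (h.rel_dir f S'))

theorem inv_mono {X Y : C} (f : X ⟶ Y) {T T' : P.Cluster Y} (hT : T ≤ T') :
    h.inv f T ≤ h.inv f T' :=
  h.le_inv_iff.2 (rel_of_rel_of_le (h.rel_inv f T) hT)

theorem rel_comp_iff_dir {X Y Z : C} {f : X ⟶ Y} {g : Y ⟶ Z} {S : P.Cluster X}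
    {T : P.Cluster Z} : P.rel (f ≫ g) S T ↔ P.rel g (h.dir f S) T := by
  constructor
  · intro hT
    obtain ⟨B, hB, hB'⟩ := h.exists_between f g S T hT
    exact rel_of_le_of_rel (h.dir_le_iff.2 hB) hB'
  · exact P.rel_comp f g S _ T (h.rel_dir f S)

theorem rel_comp_iff_inv {X Y Z : C} {f : X ⟶ Y} {g : Y ⟶ Z} {S : P.Cluster X}
    {T : P.Cluster Z} : P.rel (f ≫ g) S T ↔ P.rel f S (h.inv g T) := by
  constructor
  · intro hT
    obtain ⟨B, hB, hB'⟩ := h.exists_between f g S T hT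
    exact rel_of_rel_of_le hB (h.le_inv_iff.2 hB')
  · exact fun hS => P.rel_comp f g S _ T hS (h.rel_inv g T)

theorem dir_comp {X Y Z : C} (f : X ⟶ Y) (g : Y ⟶ Z) (S : P.Cluster X) :
    h.dir (f ≫ g) S = h.dir g (h.dir f S) :=
  eq_of_forall_ge_iff fun T => by rw [h.dir_le_iff, h.dir_le_iff, h.rel_comp_iff_dir]

theorem inv_comp {X Y Z : C} (f : X ⟶ Y) (g : Y ⟶ Z) (T : P.Cluster Z) :
    h.inv (f ≫ g) T = h.inv f (h.inv g T) :=
  eq_of_forall_le_iff fun S => by rw [h.le_inv_iff, h.le_inv_iff, h.rel_comp_iff_inv]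

theorem dir_id {X : C} (S : P.Cluster X) : h.dir (𝟙 X) S = S :=
  eq_of_forall_ge_iff fun _ => h.dir_le_iff

theorem dir_bot {X Y : C} (f : X ⟶ Y) : h.dir f (h.bot X) = h.bot Y :=
  le_antisymm (h.dir_le_iff.2 (h.le_inv_iff.1 (h.bot_le _))) (h.bot_le _)

theorem im_comp {X Y Z : C} (f : X ⟶ Y) (g : Y ⟶ Z) : h.im (f ≫ g) = h.dir g (h.im f) :=
  h.dir_comp f g _

theorem ker_comp {X Y Z : C} (f : X ⟶ Y) (g : Y ⟶ Z) : h.ker (f ≫ g) = h.inv f (h.ker g) :=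
  h.inv_comp f g _

theorem im_comp_le {X Y Z : C} (f : X ⟶ Y) (g : Y ⟶ Z) : h.im (f ≫ g) ≤ h.im g := by
  rw [h.im_comp]
  exact h.dir_mono g (h.le_top _)

theorem ker_le_comp {X Y Z : C} (f : X ⟶ Y) (g : Y ⟶ Z) : h.ker f ≤ h.ker (f ≫ g) := by
  rw [h.ker_comp]
  exact h.inv_mono f (h.bot_le _)

theorem ker_eq_bot_of_isIso {X Y : C} (f : X ⟶ Y) [IsIso f] : h.ker f = h.bot X := by
  refine le_antisymm ?_ (h.bot_le _)
  have : h.dir f (h.ker f) ≤ h.bot Y := h.dir_le_iff.2 (h.rel_inv f _)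
  have := h.dir_mono (CategoryTheory.inv f) this
  rwa [← h.dir_comp, IsIso.hom_inv_id, h.dir_id, h.dir_bot] at this

theorem im_eq_top_of_isIso {X Y : C} (f : X ⟶ Y) [IsIso f] : h.im f = h.top Y := by
  refine le_antisymm (h.le_top _) ?_
  have := h.dir_mono f (h.le_top (h.dir (CategoryTheory.inv f) (h.top Y)))
  rwa [← h.dir_comp, IsIso.inv_hom_id, h.dir_id] at this

end IsOrean

/-! ### Subforms of closed clusters -/

namespace Operator

variable {κ : Operator P P}

/-- For a closure operator, meets and inverse images of closed clusters are already closed, while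
bottom, joins and direct images are obtained by closing those of `P`. -/
theorem isOrean_closed (h : P.IsOrean) (hi : κ.IsIdempotent)
    (hle : ∀ {X : C} (S : P.Cluster X), S ≤ κ.toFun S) : κ.closed.IsOrean where
  exists_bot X := ⟨⟨κ.toFun (h.bot X), hi _⟩, fun S =>
    show P.rel _ _ _ from S.2 ▸ κ.monotone _ _ _ (h.bot_le S.1)⟩
  exists_top X := ⟨⟨h.top X, le_antisymm (h.le_top _) (hle _)⟩, fun S => h.le_top S.1⟩
  exists_sup A B := by
    obtain ⟨S, hS⟩ := h.exists_sup A.1 B.1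
    refine ⟨⟨κ.toFun S, hi S⟩, ?_, ?_⟩
    · rintro U (rfl | rfl)
      · exact (hS.1 (by simp)).trans (hle S)
      · exact (hS.1 (by simp)).trans (hle S)
    · intro U hU
      have h1 : S ≤ U.1 := hS.2 (by
        rintro V (rfl | rfl)
        · exact hU (Set.mem_insert _ _)
        · exact hU (Set.mem_insert_of_mem _ rfl))
      have := κ.monotone _ _ _ h1
      rw [U.2] at this
      exact this
  exists_inf A B := by
    obtain ⟨S, hS⟩ := h.exists_inf A.1 B.1
    have hA : κ.toFun S ≤ A.1 := by
      have := κ.monotone _ _ _ (show S ≤ A.1 from hS.1 (by simp))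
      rwa [A.2] at this
    have hB : κ.toFun S ≤ B.1 := by
      have := κ.monotone _ _ _ (show S ≤ B.1 from hS.1 (by simp))
      rwa [B.2] at this
    refine ⟨⟨S, le_antisymm (hS.2 ?_) (hle S)⟩, ?_, ?_⟩
    · rintro V (rfl | rfl)
      exacts [hA, hB]
    · rintro U (rfl | rfl)
      · exact hS.1 (by simp)
      · exact hS.1 (by simp)
    · intro U hU
      refine hS.2 ?_
      rintro V (rfl | rfl)
      · exact hU (Set.mem_insert _ _)
      · exact hU (Set.mem_insert_of_mem _ rfl)
  exists_between f g A D hAD := by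
    obtain ⟨B, hB, hB'⟩ := h.exists_between f g A.1 D.1 hAD
    have := κ.monotone _ _ _ hB'
    rw [D.2] at this
    have hAB : P.rel f A.1 (κ.toFun B) := rel_of_rel_of_le hB (hle B)
    exact ⟨⟨κ.toFun B, hi B⟩, hAB, this⟩
  exists_directImage f S := by
    refine ⟨⟨κ.toFun (h.dir f S.1), hi _⟩, rel_of_rel_of_le (h.rel_dir f S.1) (hle _), ?_⟩
    intro U hU
    have := κ.monotone _ _ _ (h.dir_le_iff.2 hU)
    rw [U.2] at this
    exact this
  exists_inverseImage f T := by
    have h1 := κ.monotone _ _ _ (h.rel_inv f T.1)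
    rw [T.2] at h1
    exact ⟨⟨h.inv f T.1, le_antisymm (h.le_inv_iff.2 h1) (hle _)⟩, h.rel_inv f T.1,
      fun U hU => h.le_inv_iff.2 hU⟩

theorem isImage_closed (h : P.IsOrean) (hi : κ.IsIdempotent)
    (hle : ∀ {X : C} (S : P.Cluster X), S ≤ κ.toFun S) {X Y : C} (f : X ⟶ Y) :
    κ.closed.IsImage f ⟨κ.toFun (h.im f), hi _⟩ := by
  refine ⟨⟨h.top X, le_antisymm (h.le_top _) (hle _)⟩, fun S => h.le_top S.1,
    rel_of_rel_of_le (h.rel_dir f _) (hle _), ?_⟩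
  intro U hU
  have := κ.monotone _ _ _ (h.dir_le_iff.2 hU)
  rw [U.2] at this
  exact this

theorem isKernel_closed (h : P.IsOrean) (hi : κ.IsIdempotent) {X Y : C} (f : X ⟶ Y)
    (hf : κ.toFun (h.ker f) = h.inv f (κ.toFun (h.bot Y))) :
    κ.closed.IsKernel f ⟨κ.toFun (h.ker f), hi _⟩ := by
  refine ⟨⟨κ.toFun (h.bot Y), hi _⟩, fun S => ?_, ?_, ?_⟩
  · have := κ.monotone _ _ _ (h.bot_le S.1)
    rw [S.2] at this
    exact this
  · exact κ.monotone _ _ _ (h.rel_inv f _)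
  · intro U hU
    change U.1 ≤ κ.toFun (h.ker f)
    rw [hf]
    exact h.le_inv_iff.2 hU

end Operator

/-- Two closure operators, the closed clusters of which are the images and the kernels of
morphisms, respectively, form an exact meet decomposition as soon as every cluster is the meet of
its closures and the first one commutes with the formation of kernels. -/
theorem isExactMeetDecomposition_of_closure (h : P.IsOrean) {κs κe : Operator P P}
    (hs : κs.IsIdempotent) (he : κe.IsIdempotent)
    (meet : ∀ {X : C} (S : P.Cluster X), IsGLB {κs.toFun S, κe.toFun S} S)
    (conormal : ∀ {X : C} (S : P.Cluster X), κs.toFun S = S → P.IsConormal S)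
    (normal : ∀ {X : C} (S : P.Cluster X), κe.toFun S = S → P.IsNormal S)
    (im_closed : ∀ {X Y : C} (f : X ⟶ Y), κs.toFun (h.im f) = h.im f)
    (ker_closed : ∀ {X Y : C} (f : X ⟶ Y), κe.toFun (h.ker f) = h.ker f)
    (ker_s : ∀ {X Y : C} (f : X ⟶ Y), κs.toFun (h.ker f) = h.inv f (κs.toFun (h.bot Y))) :
    P.IsExactMeetDecomposition κs κe := by
  have les : ∀ {X : C} (S : P.Cluster X), S ≤ κs.toFun S := fun S => (meet S).1 (by simp)
  have lee : ∀ {X : C} (S : P.Cluster X), S ≤ κe.toFun S := fun S => (meet S).1 (by simp)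
  have hos := Operator.isOrean_closed h hs les
  have hoe := Operator.isOrean_closed h he lee
  -- The bottom cluster is the kernel of an identity morphism, hence closed.
  have bot_e : ∀ Y : C, κe.toFun (h.bot Y) = h.bot Y := by
    intro Y
    have := ker_closed (𝟙 Y)
    rwa [h.ker_eq_bot_of_isIso] at this
  have ims : ∀ {X Y : C} (f : X ⟶ Y), hos.im f = ⟨κs.toFun (h.im f), hs _⟩ := fun f =>
    (hos.isImage_iff.1 (Operator.isImage_closed h hs les f)).symm
  have ime : ∀ {X Y : C} (f : X ⟶ Y), hoe.im f = ⟨κe.toFun (h.im f), he _⟩ := fun f =>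
    (hoe.isImage_iff.1 (Operator.isImage_closed h he lee f)).symm
  have kers : ∀ {X Y : C} (f : X ⟶ Y), hos.ker f = ⟨κs.toFun (h.ker f), hs _⟩ := fun f =>
    (hos.isKernel_iff.1 (Operator.isKernel_closed h hs f (ker_s f))).symm
  have kere : ∀ {X Y : C} (f : X ⟶ Y), hoe.ker f = ⟨κe.toFun (h.ker f), he _⟩ := fun f =>
    (hoe.isKernel_iff.1 (Operator.isKernel_closed h he f (by
      rw [ker_closed, bot_e]; rfl))).symm
  refine
    { idem_s := hs, idem_e := he, orean_s := hos, orean_e := hoe, meet := meet,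
      conormal_s := ?_, normal_e := ?_, binormal_s := ⟨?_, ?_⟩, binormal_e := ⟨?_, ?_⟩,
      -- The operators between the two subforms are restrictions of `κe` and `κs`. They preserve
      -- images and kernels, respectively, because images are `κs`-closed and kernels are
      -- `κe`-closed.
      exists_conormal := ⟨⟨fun S => ⟨κe.toFun S.1, he _⟩,
        fun f A B hAB => κe.monotone f _ _ hAB⟩, ?_⟩,
      exists_normal := ⟨⟨fun S => ⟨κs.toFun S.1, hs _⟩,
        fun f A B hAB => κs.monotone f _ _ hAB⟩, ?_⟩,
      inclusion_s := ?_, inclusion_e := ?_ }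
  · intro X S
    obtain ⟨W, f, hf⟩ := conormal S.1 S.2
    refine ⟨W, f, hos.isImage_iff.2 (Subtype.ext ?_)⟩
    rw [ims, ← h.isImage_iff.1 hf]
    exact S.2.symm
  · intro X S
    obtain ⟨W, f, hf⟩ := normal S.1 S.2
    refine ⟨W, f, hoe.isKernel_iff.2 (Subtype.ext ?_)⟩
    rw [kere, ← h.isKernel_iff.1 hf]
    exact S.2.symm
  · intro X Y f S hS
    rw [h.isImage_iff] at hS
    subst hS
    exact hos.isImage_iff.2 (ims f).symm
  · intro X Y f S hS
    rw [h.isKernel_iff] at hS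
    subst hS
    exact hos.isKernel_iff.2 (kers f).symm
  · intro X Y f S hS
    rw [h.isImage_iff] at hS
    subst hS
    exact hoe.isImage_iff.2 (ime f).symm
  · intro X Y f S hS
    rw [h.isKernel_iff] at hS
    subst hS
    exact hoe.isKernel_iff.2 (kere f).symm
  · intro X Y f S hS
    rw [hos.isImage_iff, ims] at hS
    subst hS
    rw [hoe.isImage_iff, ime]
    exact Subtype.ext (congrArg κe.toFun (im_closed f))
  · intro X Y f S hS
    rw [hoe.isKernel_iff, kere] at hS
    subst hS
    rw [hos.isKernel_iff, kers]
    exact Subtype.ext (congrArg κs.toFun (ker_closed f))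
  · intro X Y f S hS
    rw [hos.isImage_iff, ims] at hS
    subst hS
    exact h.isImage_iff.2 (im_closed f)
  · intro X Y f S hS
    rw [hoe.isKernel_iff, kere] at hS
    subst hS
    exact h.isKernel_iff.2 (ker_closed f)

end ClusterSystem

/-! ### Quotients of the initial object. -/

/-- An object all parallel morphisms from which are equal. When there is an initial object, these
are its quotients. -/
def Subinitial {C : Type*} [Category C] (Q : C) : Prop := ∀ ⦃Z : C⦄ (u v : Q ⟶ Z), u = v

theorem Subinitial.epi {C : Type*} [Category C] {Q : C} (hQ : Subinitial Q) {A : C} (q : A ⟶ Q) :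
    Epi q := ⟨fun _ _ _ => hQ _ _⟩

theorem Subinitial.of_epi {C : Type*} [Category C] {Q : C} (hQ : Subinitial Q) {A : C} (q : Q ⟶ A)
    [Epi q] : Subinitial A := fun _ u v => by rw [← cancel_epi q]; exact hQ _ _

theorem Subinitial.of_isInitial {C : Type*} [Category C] {Q : C} (hQ : IsInitial Q) :
    Subinitial Q := fun _ u v => hQ.hom_ext u v

namespace ClusterSystem

variable {C : Type u} [Category.{v} C] {P : ClusterSystem.{w} C}

/-! ### Consequences of the noetherian axioms, mostly over a balanced category. -/

namespace IsNoetherian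

variable (hN : P.IsNoetherian)
include hN

/-- If `e ≫ u = e ≫ v`, both `u` and `v` are the unique factorization of this composite, whose
kernel contains that of `e`. -/
theorem epi_of_isQuotient {X Y : C} {e : X ⟶ Y} {K : P.Cluster X} (he : P.IsQuotient e K) :
    Epi e := by
  refine ⟨fun {Z} u v huv => ?_⟩
  have h := hN.isOrean
  obtain ⟨hK, hu⟩ := he
  rw [h.isKernel_iff] at hK
  subst hK
  exact (hu Z (e ≫ u) _ (h.isKernel_iff.2 rfl) (h.ker_le_comp e u)).unique rfl huv.symm

theorem mono_of_isEmbedding {X Y : C} {m : X ⟶ Y} {S : P.Cluster Y} (hm : P.IsEmbedding m S) :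
    Mono m := by
  refine ⟨fun {Z} u v huv => ?_⟩
  have h := hN.isOrean
  obtain ⟨hS, hu⟩ := hm
  rw [h.isImage_iff] at hS
  subst hS
  exact (hu Z (u ≫ m) _ (h.isImage_iff.2 rfl) (h.im_comp_le u m)).unique rfl huv.symm

/-- The factorization of a morphism, in terms of lifting properties. -/
theorem exists_fac {X Y : C} (f : X ⟶ Y) : ∃ (W : C) (e : X ⟶ W) (m : W ⟶ Y), Epi e ∧ Mono m ∧
    e ≫ m = f ∧ hN.isOrean.ker e = hN.isOrean.ker f ∧ hN.isOrean.im m = hN.isOrean.im f ∧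
    (∀ {Z : C} (g : X ⟶ Z), hN.isOrean.ker f ≤ hN.isOrean.ker g → ∃ t, e ≫ t = g) ∧
    ∀ {Z : C} (g : Z ⟶ Y), hN.isOrean.im g ≤ hN.isOrean.im f → ∃ t, t ≫ m = g := by
  have h := hN.isOrean
  obtain ⟨W, e, m, K, I, hK, hI, he, hm, hf⟩ := hN.factorization f
  have he' := hN.epi_of_isQuotient he
  have hm' := hN.mono_of_isEmbedding hm
  obtain ⟨hK', hu⟩ := he
  obtain ⟨hI', hv⟩ := hm
  rw [h.isKernel_iff] at hK hK'
  rw [h.isImage_iff] at hI hI'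
  subst hK hI
  exact ⟨W, e, m, he', hm', hf, hK'.symm, hI'.symm,
    fun g hg => (hu _ g _ (h.isKernel_iff.2 rfl) hg).exists,
    fun g hg => (hv _ g _ (h.isImage_iff.2 rfl) hg).exists⟩

/-- The identity of `Y` has image below `Im f`, so it factors through the embedding part of `f`,
which is then a split epimorphism. -/
theorem epi_of_im_eq_top {X Y : C} (f : X ⟶ Y) (hf : hN.isOrean.im f = hN.isOrean.top Y) :
    Epi f := by
  obtain ⟨W, e, m, he, hm, rfl, -, -, -, hv⟩ := hN.exists_fac f
  obtain ⟨t, ht⟩ := hv (𝟙 Y) (hf ▸ hN.isOrean.le_top _)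
  have : Epi m := (SplitEpi.mk t ht).epi
  exact epi_comp e m

theorem isLUB_inv_dir {X Y : C} (f : X ⟶ Y) (S : P.Cluster X) :
    IsLUB {S, hN.isOrean.ker f} (hN.isOrean.inv f (hN.isOrean.dir f S)) :=
  hN.inverse_direct f S _ _ _ (hN.isOrean.isDirectImage_dir f S)
    (hN.isOrean.isInverseImage_inv f _) (hN.isOrean.isKernel_iff.2 rfl)

theorem isGLB_dir_inv {X Y : C} (f : X ⟶ Y) (T : P.Cluster Y) :
    IsGLB {T, hN.isOrean.im f} (hN.isOrean.dir f (hN.isOrean.inv f T)) :=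
  hN.direct_inverse f T _ _ _ (hN.isOrean.isInverseImage_inv f T)
    (hN.isOrean.isDirectImage_dir f _) (hN.isOrean.isImage_iff.2 rfl)

theorem dir_inv_of_le_im {X Y : C} (f : X ⟶ Y) (T : P.Cluster Y) (hT : T ≤ hN.isOrean.im f) :
    hN.isOrean.dir f (hN.isOrean.inv f T) = T := by
  refine (hN.isGLB_dir_inv f T).unique ⟨?_, fun U hU => hU (by simp)⟩
  rintro U (rfl | rfl)
  exacts [le_rfl, hT]

variable [Balanced C]

/-- In a factorization `f = e ≫ m` of a monomorphism, `e` is both mono and epi, hence invertible. So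
every monomorphism is an embedding of its image; dually for epimorphisms in the lemmas below. -/
theorem exists_comp_eq_of_im_le {X Y Z : C} (f : X ⟶ Y) [Mono f] (g : Z ⟶ Y)
    (hg : hN.isOrean.im g ≤ hN.isOrean.im f) : ∃ t, t ≫ f = g := by
  obtain ⟨W, e, m, he, hm, rfl, -, -, -, hv⟩ := hN.exists_fac f
  have : Mono e := mono_of_mono e m
  have : IsIso e := isIso_of_mono_of_epi e
  obtain ⟨t, ht⟩ := hv g hg
  exact ⟨t ≫ CategoryTheory.inv e, by simpa using ht⟩

theorem exists_comp_eq_of_ker_le {X Y Z : C} (f : X ⟶ Y) [Epi f] (g : X ⟶ Z)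
    (hg : hN.isOrean.ker f ≤ hN.isOrean.ker g) : ∃ t, f ≫ t = g := by
  obtain ⟨W, e, m, he, hm, rfl, -, -, hv, -⟩ := hN.exists_fac f
  have : Epi m := epi_of_epi e m
  have : IsIso m := isIso_of_mono_of_epi m
  obtain ⟨t, ht⟩ := hv g hg
  exact ⟨CategoryTheory.inv m ≫ t, by simpa using ht⟩

theorem ker_of_mono {X Y : C} (f : X ⟶ Y) [Mono f] : hN.isOrean.ker f = hN.isOrean.bot X := by
  obtain ⟨W, e, m, he, hm, rfl, hk, -, -, -⟩ := hN.exists_fac f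
  have : Mono e := mono_of_mono e m
  have : IsIso e := isIso_of_mono_of_epi e
  rw [← hk, hN.isOrean.ker_eq_bot_of_isIso]

theorem im_of_epi {X Y : C} (f : X ⟶ Y) [Epi f] : hN.isOrean.im f = hN.isOrean.top Y := by
  obtain ⟨W, e, m, he, hm, rfl, -, hi, -, -⟩ := hN.exists_fac f
  have : Epi m := epi_of_epi e m
  have : IsIso m := isIso_of_mono_of_epi m
  rw [← hi, hN.isOrean.im_eq_top_of_isIso]

theorem inv_dir_of_mono {X Y : C} (f : X ⟶ Y) [Mono f] (S : P.Cluster X) :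
    hN.isOrean.inv f (hN.isOrean.dir f S) = S := by
  refine (hN.isLUB_inv_dir f S).unique ?_
  rw [hN.ker_of_mono]
  refine ⟨?_, fun U hU => hU (by simp)⟩
  rintro U (rfl | rfl)
  exacts [le_rfl, hN.isOrean.bot_le _]

theorem dir_inv_of_epi {X Y : C} (f : X ⟶ Y) [Epi f] (T : P.Cluster Y) :
    hN.isOrean.dir f (hN.isOrean.inv f T) = T := by
  refine (hN.isGLB_dir_inv f T).unique ?_
  rw [hN.im_of_epi]
  refine ⟨?_, fun U hU => hU (by simp)⟩
  rintro U (rfl | rfl)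
  exacts [le_rfl, hN.isOrean.le_top _]

/-- The kernel of a pushout of two epimorphisms is the join of their kernels. -/
theorem isLUB_ker_of_isPushout {X Y Z W : C} {x : X ⟶ Y} {y : X ⟶ Z} {x' : Y ⟶ W} {y' : Z ⟶ W}
    [Epi x] [Epi y] (hp : IsPushout x y x' y') :
    IsLUB {hN.isOrean.ker x, hN.isOrean.ker y} (hN.isOrean.ker (x ≫ x')) := by
  have h := hN.isOrean
  obtain ⟨S, hS⟩ := h.exists_sup (h.ker x) (h.ker y)
  -- Normality makes the join of the two kernels a kernel `Ker k`; then `k` factors through both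
  -- epimorphisms, hence through the pushout.
  obtain ⟨V, k, hk⟩ := hN.normal_sup _ _ S ⟨_, x, h.isKernel_iff.2 rfl⟩
    ⟨_, y, h.isKernel_iff.2 rfl⟩ hS
  rw [h.isKernel_iff] at hk
  subst hk
  obtain ⟨s, hs⟩ := hN.exists_comp_eq_of_ker_le x k (hS.1 (by simp))
  obtain ⟨t, ht⟩ := hN.exists_comp_eq_of_ker_le y k (hS.1 (by simp))
  have hd : (x ≫ x') ≫ hp.desc s t (by rw [hs, ht]) = k := by simp [hs]
  have hle : h.ker (x ≫ x') ≤ h.ker k := by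
    rw [← hd]
    exact h.ker_le_comp _ _
  have hge : h.ker k ≤ h.ker (x ≫ x') := by
    refine hS.2 ?_
    rintro U (rfl | rfl)
    · exact h.ker_le_comp _ _
    · rw [hp.w]
      exact h.ker_le_comp _ _
  rwa [le_antisymm hle hge]

/-- The direct image of a kernel along an epimorphism is given by the pushout. -/
theorem dir_ker_of_isPushout {X Y Z W : C} {x : X ⟶ Y} {y : X ⟶ Z} {x' : Y ⟶ W} {y' : Z ⟶ W}
    [Epi x] [Epi y] (hp : IsPushout x y x' y') :
    hN.isOrean.dir x (hN.isOrean.ker y) = hN.isOrean.ker x' := by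
  have h := hN.isOrean
  -- Both `(x · Ker y) · x` and `Ker (x ≫ x')` are the join of `Ker x` and `Ker y`; applying `x ·`
  -- to them gives the claim.
  have h1 := (hN.isLUB_inv_dir x (h.ker y)).unique
    (Set.pair_comm _ _ ▸ hN.isLUB_ker_of_isPushout hp)
  rw [h.ker_comp] at h1
  rw [← hN.dir_inv_of_epi x (h.dir x (h.ker y)), h1, hN.dir_inv_of_epi]

end IsNoetherian

/-! ### Consequences of an exact meet decomposition. -/

namespace IsExactMeetDecomposition

variable {κs κe : Operator P P} (hd : P.IsExactMeetDecomposition κs κe) (hN : P.IsNoetherian)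
include hd

theorem le_s {X : C} (S : P.Cluster X) : S ≤ κs.toFun S := (hd.meet S).1 (by simp)

theorem le_e {X : C} (S : P.Cluster X) : S ≤ κe.toFun S := (hd.meet S).1 (by simp)

include hN

theorem exists_im_eq {X : C} {S : P.Cluster X} (hS : κs.toFun S = S) :
    ∃ (W : C) (f : W ⟶ X), hN.isOrean.im f = S := by
  obtain ⟨W, f, hf⟩ := hd.conormal_s ⟨S, hS⟩
  exact ⟨W, f, (hN.isOrean.isImage_iff.1 (hd.inclusion_s f _ hf)).symm⟩

theorem exists_ker_eq {X : C} {S : P.Cluster X} (hS : κe.toFun S = S) :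
    ∃ (Y : C) (f : X ⟶ Y), hN.isOrean.ker f = S := by
  obtain ⟨W, f, hf⟩ := hd.normal_e ⟨S, hS⟩
  exact ⟨W, f, (hN.isOrean.isKernel_iff.1 (hd.inclusion_e f _ hf)).symm⟩

theorem s_im {X Y : C} (f : X ⟶ Y) : κs.toFun (hN.isOrean.im f) = hN.isOrean.im f := by
  have h1 := hd.inclusion_s f _ (hd.orean_s.isImage_iff.2 rfl)
  rw [hN.isOrean.isImage_iff] at h1
  rw [← h1]
  exact (hd.orean_s.im f).2

variable [Balanced C]

/-- The top cluster is `κe`-closed, hence the kernel of some morphism out of `X`. That morphism is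
mono because `X` is terminal, so its kernel is the bottom. -/
theorem top_eq_bot_of_isTerminal {X : C} (hX : IsTerminal X) :
    hN.isOrean.top X = hN.isOrean.bot X := by
  obtain ⟨Y, f, hf⟩ := hd.exists_ker_eq hN
    (le_antisymm (hN.isOrean.le_top _) (hd.le_e (hN.isOrean.top X)))
  have : Mono f := ⟨fun _ _ _ => hX.hom_ext _ _⟩
  rw [← hf, hN.ker_of_mono]

theorem epi_of_isTerminal {X W : C} (hX : IsTerminal X) (f : W ⟶ X) : Epi f :=
  hN.epi_of_im_eq_top f (le_antisymm (hN.isOrean.le_top _)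
    (hd.top_eq_bot_of_isTerminal hN hX ▸ hN.isOrean.bot_le _))

/-- The cluster `κs S` is the image of some morphism into `Q`, and all morphisms into `Q` are epi.
-/
theorem s_eq_top_of_subinitial {Q : C} (hQ : Subinitial Q) (S : P.Cluster Q) :
    κs.toFun S = hN.isOrean.top Q := by
  obtain ⟨W, f, hf⟩ := hd.exists_im_eq hN (hd.idem_s S)
  have := hQ.epi f
  rw [← hf, hN.im_of_epi]

/-- Since `κs` preserves kernels, the left side is the inverse image along `q` of the bottom of the
subform over `Q`, which is the top cluster of `Q`. -/
theorem s_ker_of_subinitial {A Q : C} (hQ : Subinitial Q) (q : A ⟶ Q) :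
    κs.toFun (hN.isOrean.ker q) = hN.isOrean.top A := by
  have h := hN.isOrean
  have h1 := hd.orean_s.isKernel_iff.1 (hd.binormal_s.2 q _ (h.isKernel_iff.2 rfl))
  refine le_antisymm (h.le_top _) ?_
  have h2 : κs.closed.rel q ⟨h.top A, le_antisymm (h.le_top _) (hd.le_s _)⟩
      (hd.orean_s.bot Q) := by
    change P.rel q (h.top A) (hd.orean_s.bot Q).1
    rw [← (hd.orean_s.bot Q).2, hd.s_eq_top_of_subinitial hN hQ]
    exact rel_of_rel_of_le (h.rel_dir q _) (h.le_top _)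
  have h3 := hd.orean_s.le_inv_iff.2 h2
  change _ ≤ hd.orean_s.ker q at h3
  rw [← h1] at h3
  exact h3

/-- This recovers the subobject from its subquotient. For `≥`, apply `κs` to the relation between
`Ker q` and `a · Ker q`: its source becomes the top cluster of `A`. -/
theorem s_dir_ker {X A Q : C} (hQ : Subinitial Q) (a : A ⟶ X) (q : A ⟶ Q) :
    κs.toFun (hN.isOrean.dir a (hN.isOrean.ker q)) = hN.isOrean.im a := by
  have h := hN.isOrean
  apply le_antisymm
  · have := κs.monotone _ _ _ (h.dir_mono a (h.le_top (h.ker q)))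
    change _ ≤ κs.toFun (h.im a) at this
    rwa [hd.s_im hN] at this
  · have := κs.monotone _ _ _ (h.rel_dir a (h.ker q))
    rw [hd.s_ker_of_subinitial hN hQ] at this
    exact h.dir_le_iff.2 this

/-- Pushouts of quotients of the initial object along monomorphisms are monomorphisms. -/
theorem mono_of_isPushout {A X Q Y : C} {a : A ⟶ X} {q : A ⟶ Q} {x : X ⟶ Y} {y : Q ⟶ Y}
    (hQ : Subinitial Q) [Mono a] (hp : IsPushout a q x y) : Mono y := by
  have h := hN.isOrean
  have := hQ.epi q
  obtain ⟨Z, g, hg⟩ := hd.exists_ker_eq hN (hd.idem_e (h.dir a (h.ker q)))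
  have hle : h.dir a (h.ker q) ≤ h.ker g := hg ▸ hd.le_e _
  -- Here `Ker g = κe (a · Ker q)` and `κs (a · Ker q) = Im a`. The direct image of `Ker (a ≫ g)`
  -- along `a` lies below both, hence below their meet `a · Ker q`, and `a` is mono.
  have hag : h.ker (a ≫ g) = h.ker q := by
    apply le_antisymm
    · rw [← hN.inv_dir_of_mono a (h.ker q), h.le_inv_iff, ← h.dir_le_iff]
      refine (hd.meet _).2 ?_
      rintro U (rfl | rfl)
      · rw [hd.s_dir_ker hN hQ]
        exact h.dir_mono a (h.le_top _)
      · rw [← hg, h.dir_le_iff, ← h.le_inv_iff, ← h.ker_comp]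
    · rw [h.ker_comp, h.le_inv_iff, ← h.dir_le_iff]
      exact hle
  obtain ⟨W, e, m, he, hm, hf, hk, -, hu, -⟩ := hN.exists_fac (a ≫ g)
  obtain ⟨t, ht⟩ := hN.exists_comp_eq_of_ker_le q (a ≫ g) hag.ge
  obtain ⟨s, hs⟩ := hu q hag.le
  -- Parallel morphisms out of `Q` agree, so `r` is split mono and `t` is the monomorphism `r ≫ m`;
  -- moreover `t` factors as `y` followed by a morphism.
  obtain ⟨r, hr⟩ := hN.exists_comp_eq_of_ker_le q e (hk.trans hag).ge
  have hrs : r ≫ s = 𝟙 Q := hQ _ _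
  have : Mono r := (SplitMono.mk s hrs).mono
  have htr : t = r ≫ m := hQ _ _
  have : Mono t := htr ▸ mono_comp r m
  have hyt : y ≫ hp.desc g t ht.symm = t := by simp
  exact mono_of_mono_fac hyt

/-- Inverse images along a morphism of clusters given by subquotients are computed by pullbacks. -/
theorem inv_dir_ker_of_isPullback {X Y A B Q : C} {e : X ⟶ Y} {a : A ⟶ X} {b : B ⟶ Y}
    {g : A ⟶ B} (hp : IsPullback a g e b) [Mono b] (q : B ⟶ Q) :
    hN.isOrean.inv e (hN.isOrean.dir b (hN.isOrean.ker q)) =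
      hN.isOrean.dir a (hN.isOrean.ker (g ≫ q)) := by
  have h := hN.isOrean
  -- The inverse image of `Im b` is `κs`-closed, hence the image of some `c`. As `c ≫ e` factors
  -- through `b`, `c` factors through the pullback `a`; so the cluster sought lies below `Im a` and
  -- is determined by its inverse image along `a`.
  have hclosed : κs.toFun (h.inv e (h.im b)) = h.inv e (h.im b) := by
    refine le_antisymm ?_ (hd.le_s _)
    have := κs.monotone _ _ _ (h.rel_inv e (h.im b))
    rw [hd.s_im hN] at this
    exact h.le_inv_iff.2 this
  obtain ⟨D, c, hc⟩ := hd.exists_im_eq hN hclosed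
  have hce : h.im (c ≫ e) ≤ h.im b := by
    rw [h.im_comp, h.dir_le_iff, hc]
    exact h.rel_inv e _
  obtain ⟨t, ht⟩ := hN.exists_comp_eq_of_im_le b (c ≫ e) hce
  have hle : h.inv e (h.dir b (h.ker q)) ≤ h.im a := by
    refine (h.inv_mono e (h.dir_mono b (h.le_top _))).trans ?_
    change h.inv e (h.im b) ≤ _
    rw [← hc, ← hp.lift_fst c t ht.symm]
    exact h.im_comp_le _ _
  rw [← hN.dir_inv_of_le_im a _ hle, ← h.inv_comp, hp.w, h.inv_comp, hN.inv_dir_of_mono,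
    h.ker_comp]

end IsExactMeetDecomposition

end ClusterSystem

/-! ### Epi-mono factorizations in a balanced category. -/

/-- Every morphism is an epimorphism followed by a monomorphism, and epimorphisms are orthogonal
to monomorphisms. -/
structure EpiMonoFactorizations (C : Type u) [Category.{v} C] : Prop where
  exists_fac : ∀ {X Y : C} (f : X ⟶ Y),
    ∃ (W : C) (e : X ⟶ W) (m : W ⟶ Y), Epi e ∧ Mono m ∧ e ≫ m = f
  exists_lift : ∀ {X Y Z W : C} (e : X ⟶ Y) (m : Z ⟶ W) (f : X ⟶ Z) (g : Y ⟶ W), Epi e → Mono m →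
    e ≫ g = f ≫ m → ∃ d : Y ⟶ Z, e ≫ d = f ∧ d ≫ m = g

theorem IsProperFactorizationSystem.epiMonoFactorizations {C : Type u} [Category.{v} C]
    [Balanced C] {E M : MorphismProperty C} (h : IsProperFactorizationSystem E M) :
    EpiMonoFactorizations C where
  exists_fac f := by
    obtain ⟨W, e, m, he, hm, hf⟩ := h.factorization f
    exact ⟨W, e, m, h.epi_right _ he, h.mono_left _ hm, hf⟩
  exists_lift := by
    intro X Y Z W e m f g he hm hw
    -- Being mono and epi, `m₁` and `e₂` are invertible: up to isomorphism every epimorphism lies in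
    -- `E` and every monomorphism in `M`.
    obtain ⟨V, e₁, m₁, he₁, hm₁, rfl⟩ := h.factorization e
    obtain ⟨V', e₂, m₂, he₂, hm₂, rfl⟩ := h.factorization m
    have : Mono m₁ := h.mono_left _ hm₁
    have : Epi e₂ := h.epi_right _ he₂
    have : Epi m₁ := epi_of_epi e₁ m₁
    have : Mono e₂ := mono_of_mono e₂ m₂
    have : IsIso m₁ := isIso_of_mono_of_epi m₁
    have : IsIso e₂ := isIso_of_mono_of_epi e₂
    obtain ⟨d, ⟨hd, hd'⟩, -⟩ := h.diagonal e₁ m₂ (f ≫ e₂) (m₁ ≫ g) he₁ hm₂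
      (by simpa using hw)
    exact ⟨CategoryTheory.inv m₁ ≫ d ≫ CategoryTheory.inv e₂, by simp [reassoc_of% hd],
      by simp [hd']⟩

/-! ### Subquotients: relations, images, joins and meets. -/

/-- A subobject `ι` of `X` with a quotient `π` of it that is also a quotient of the initial
object. -/
structure Subquotient {C : Type u} [Category.{v} C] (X : C) where
  /-- the subobject -/
  dom : C
  /-- the quotient of the subobject -/
  quo : C
  /-- the inclusion -/
  ι : dom ⟶ X
  /-- the projection -/
  π : dom ⟶ quo
  mono_ι : Mono ι
  subinitial : Subinitial quo

namespace Subquotient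

variable {C : Type u} [Category.{v} C]

attribute [instance] mono_ι

instance {X : C} (S : Subquotient X) : Epi S.π := S.subinitial.epi S.π

/-- The relation `U ≥_f S` between subquotients. -/
def Rel {X Y : C} (f : X ⟶ Y) (S : Subquotient X) (U : Subquotient Y) : Prop :=
  ∃ (g : S.dom ⟶ U.dom) (h : S.quo ⟶ U.quo), g ≫ U.ι = S.ι ≫ f ∧ S.π ≫ h = g ≫ U.π

theorem Rel.refl {X : C} (S : Subquotient X) : Rel (𝟙 X) S S := ⟨𝟙 _, 𝟙 _, by simp, by simp⟩

theorem Rel.comp {X Y Z : C} {f : X ⟶ Y} {g : Y ⟶ Z} {S : Subquotient X} {U : Subquotient Y}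
    {V : Subquotient Z} : Rel f S U → Rel g U V → Rel (f ≫ g) S V := by
  rintro ⟨a, b, h, h'⟩ ⟨c, d, k, k'⟩
  exact ⟨a ≫ c, b ≫ d, by simp [k, reassoc_of% h], by rw [reassoc_of% h', k', Category.assoc]⟩

/-- The subquotient `V` is the direct image of `S` along `f`. -/
def IsMap {X Y : C} (f : X ⟶ Y) (S : Subquotient X) (V : Subquotient Y) : Prop :=
  ∃ (g : S.dom ⟶ V.dom) (h : S.quo ⟶ V.quo), Epi g ∧ g ≫ V.ι = S.ι ≫ f ∧ IsPushout g S.π V.π h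

theorem IsMap.rel {X Y : C} {f : X ⟶ Y} {S : Subquotient X} {V : Subquotient Y} :
    IsMap f S V → Rel f S V := by
  rintro ⟨g, h, -, hg, hp⟩
  exact ⟨g, h, hg, hp.w.symm⟩

theorem IsMap.rel_of_rel (hC : EpiMonoFactorizations C) {X Y : C} {f : X ⟶ Y} {S : Subquotient X}
    {V U : Subquotient Y} : IsMap f S V → Rel f S U → Rel (𝟙 Y) V U := by
  rintro ⟨g, h, he, hg, hp⟩ ⟨g', h', hg', hh'⟩
  obtain ⟨d, hd, hd'⟩ := hC.exists_lift g U.ι g' V.ι he inferInstance (by rw [hg, hg'])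
  exact ⟨d, hp.desc (d ≫ U.π) h' (by rw [reassoc_of% hd, hh']), by simpa using hd', by simp⟩

/-- The direct image along a monomorphism. -/
def mapMono {X Y : C} (m : X ⟶ Y) [Mono m] (S : Subquotient X) : Subquotient Y where
  dom := S.dom
  quo := S.quo
  ι := S.ι ≫ m
  π := S.π
  mono_ι := mono_comp _ _
  subinitial := S.subinitial

theorem isMap_mapMono {X Y : C} (m : X ⟶ Y) [Mono m] (S : Subquotient X) :
    IsMap m S (mapMono m S) :=
  ⟨𝟙 S.dom, 𝟙 S.quo, inferInstanceAs (Epi (𝟙 S.dom)), Category.id_comp _,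
    show IsPushout (𝟙 S.dom) S.π S.π (𝟙 S.quo) from IsPushout.of_horiz_isIso ⟨by simp⟩⟩

theorem exists_isMap [HasPushouts C] (hC : EpiMonoFactorizations C) {X Y : C} (f : X ⟶ Y)
    (S : Subquotient X) : ∃ V, IsMap f S V := by
  obtain ⟨W, e, m, he, hm, hf⟩ := hC.exists_fac (S.ι ≫ f)
  exact ⟨⟨W, pushout e S.π, m, pushout.inl _ _, hm, S.subinitial.of_epi (pushout.inr e S.π)⟩,
    e, pushout.inr _ _, he, hf, IsPushout.of_hasPushout e S.π⟩

/-- The inverse image of a subquotient. -/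
noncomputable def comap [HasPullbacks C] {X Y : C} (f : X ⟶ Y) (U : Subquotient Y) :
    Subquotient X where
  dom := pullback f U.ι
  quo := U.quo
  ι := pullback.fst f U.ι
  π := pullback.snd f U.ι ≫ U.π
  mono_ι := inferInstance
  subinitial := U.subinitial

section comap

variable [HasPullbacks C]

theorem rel_comap {X Y : C} (f : X ⟶ Y) (U : Subquotient Y) : Rel f (comap f U) U :=
  ⟨pullback.snd f U.ι, 𝟙 U.quo, pullback.condition.symm, Category.comp_id _⟩

theorem rel_comp_iff {X Y Z : C} {f : X ⟶ Y} {g : Y ⟶ Z} {S : Subquotient X}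
    {U : Subquotient Z} : Rel f S (comap g U) ↔ Rel (f ≫ g) S U := by
  constructor
  · exact fun h => h.comp (rel_comap g U)
  · rintro ⟨a, b, h, h'⟩
    exact ⟨pullback.lift (S.ι ≫ f) a (by simp [h]), b, pullback.lift_fst _ _ _,
      h'.trans (pullback.lift_snd_assoc _ _ _ _).symm⟩

theorem rel_comap_iff {X Y : C} {f : X ⟶ Y} {S : Subquotient X} {U : Subquotient Y} :
    Rel (𝟙 X) S (comap f U) ↔ Rel f S U := by
  rw [rel_comp_iff, Category.id_comp]

end comap

section bot

variable [HasInitial C] (hC : EpiMonoFactorizations C)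
include hC

theorem exists_bot (X : C) : ∃ S : Subquotient X, S.quo = S.dom ∧ Subinitial S.dom ∧ IsIso S.π := by
  obtain ⟨W, e, m, he, hm, -⟩ := hC.exists_fac (initial.to X)
  have : Subinitial W := (Subinitial.of_isInitial initialIsInitial).of_epi e
  exact ⟨⟨W, W, m, 𝟙 W, hm, this⟩, rfl, this, inferInstanceAs (IsIso (𝟙 W))⟩

/-- The smallest subquotient: the image of the initial object. -/
noncomputable def bot (X : C) : Subquotient X := (exists_bot hC X).choose

theorem bot_subinitial (X : C) : Subinitial (bot hC X).dom := (exists_bot hC X).choose_spec.2.1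

instance (X : C) : IsIso (bot hC X).π := (exists_bot hC X).choose_spec.2.2

/-- The morphism from the initial object to `Q` is epi, hence orthogonal to `m`. -/
theorem exists_lift_bot {X A : C} (m : A ⟶ X) [Mono m] {Q : C} (hQ : Subinitial Q)
    (k : Q ⟶ X) : ∃ t : Q ⟶ A, t ≫ m = k := by
  obtain ⟨d, -, hd⟩ := hC.exists_lift (initial.to Q) m (initial.to A) k (hQ.epi _) inferInstance
    (initialIsInitial.hom_ext _ _)
  exact ⟨d, hd⟩

theorem rel_bot_iff {X Y : C} {f : X ⟶ Y} {S : Subquotient X} :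
    Rel f S (bot hC Y) ↔ ∃ h : S.quo ⟶ Y, S.π ≫ h = S.ι ≫ f := by
  constructor
  · rintro ⟨g, h, hg, hh⟩
    refine ⟨h ≫ CategoryTheory.inv (bot hC Y).π ≫ (bot hC Y).ι, ?_⟩
    rw [reassoc_of% hh, IsIso.hom_inv_id_assoc, hg]
  · rintro ⟨h, hh⟩
    obtain ⟨t, ht⟩ := exists_lift_bot hC (bot hC Y).ι S.subinitial h
    exact ⟨S.π ≫ t, t ≫ (bot hC Y).π, by simp [ht, hh], by simp⟩

theorem bot_rel {X Y : C} (f : X ⟶ Y) (S : Subquotient Y) : Rel f (bot hC X) S := by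
  obtain ⟨t, ht⟩ := exists_lift_bot hC S.ι (bot_subinitial hC X) ((bot hC X).ι ≫ f)
  exact ⟨t, CategoryTheory.inv (bot hC X).π ≫ t ≫ S.π, ht, by simp⟩

/-- The kernel of a morphism. -/
noncomputable def ker [HasPullbacks C] {X Y : C} (f : X ⟶ Y) : Subquotient X := comap f (bot hC Y)

theorem rel_ker_iff [HasPullbacks C] {X Y : C} {f : X ⟶ Y} {S : Subquotient X} :
    Rel (𝟙 X) S (ker hC f) ↔ ∃ h : S.quo ⟶ Y, S.π ≫ h = S.ι ≫ f := by
  rw [ker, rel_comap_iff, rel_bot_iff]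

end bot

section top

variable [HasTerminal C] (hT : Subinitial (⊤_ C))

/-- The subquotient with the same subobject and the largest quotient. -/
noncomputable def sat {X : C} (S : Subquotient X) : Subquotient X where
  dom := S.dom
  quo := ⊤_ C
  ι := S.ι
  π := terminal.from _
  mono_ι := inferInstance
  subinitial := hT

theorem rel_sat_iff {X Y : C} {f : X ⟶ Y} {S : Subquotient X} {U : Subquotient Y} :
    Rel f S (sat hT U) ↔ ∃ g : S.dom ⟶ U.dom, g ≫ U.ι = S.ι ≫ f :=
  ⟨fun ⟨g, _, hg, _⟩ => ⟨g, hg⟩,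
    fun ⟨g, hg⟩ => ⟨g, terminal.from _, hg, terminalIsTerminal.hom_ext _ _⟩⟩

/-- The image of a monomorphism. -/
noncomputable def ofMono {X A : C} (a : A ⟶ X) [Mono a] : Subquotient X where
  dom := A
  quo := ⊤_ C
  ι := a
  π := terminal.from _
  mono_ι := inferInstance
  subinitial := hT

theorem rel_ofMono_iff {X Y A : C} {f : X ⟶ Y} {S : Subquotient X} {a : A ⟶ Y} [Mono a] :
    Rel f S (ofMono hT a) ↔ ∃ g : S.dom ⟶ A, g ≫ a = S.ι ≫ f :=
  ⟨fun ⟨g, _, hg, _⟩ => ⟨g, hg⟩,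
    fun ⟨g, hg⟩ => ⟨g, terminal.from _, hg, terminalIsTerminal.hom_ext _ _⟩⟩

end top

/-- The join lives on the image of the copairing of the two subobjects; its quotient is the pushout
of the coproduct of the two projections, and a coproduct of subinitial objects is subinitial. -/
theorem exists_sup [HasBinaryCoproducts C] [HasPushouts C] (hC : EpiMonoFactorizations C) {X : C}
    (S U : Subquotient X) : ∃ J : Subquotient X, Rel (𝟙 X) S J ∧ Rel (𝟙 X) U J ∧
      ∀ V, Rel (𝟙 X) S V → Rel (𝟙 X) U V → Rel (𝟙 X) J V := by
  obtain ⟨W, e, m, he, hm, hf⟩ := hC.exists_fac (coprod.desc S.ι U.ι)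
  have hQ : Subinitial (S.quo ⨿ U.quo) := fun Z u v =>
    coprod.hom_ext (S.subinitial _ _) (U.subinitial _ _)
  have hl : coprod.inl ≫ e ≫ m = S.ι := by rw [hf, coprod.inl_desc]
  have hr : coprod.inr ≫ e ≫ m = U.ι := by rw [hf, coprod.inr_desc]
  have hp := IsPushout.of_hasPushout e (coprod.map S.π U.π)
  refine ⟨⟨W, pushout e (coprod.map S.π U.π), m, pushout.inl _ _, hm,
    hQ.of_epi (pushout.inr _ _)⟩, ⟨coprod.inl ≫ e, coprod.inl ≫ pushout.inr _ _, ?_, ?_⟩,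
    ⟨coprod.inr ≫ e, coprod.inr ≫ pushout.inr _ _, ?_, ?_⟩, ?_⟩
  · change (coprod.inl ≫ e) ≫ m = S.ι ≫ 𝟙 X
    rw [Category.assoc, hl, Category.comp_id]
  · change S.π ≫ coprod.inl ≫ pushout.inr _ _ = (coprod.inl ≫ e) ≫ pushout.inl _ _
    simp [pushout.condition]
  · change (coprod.inr ≫ e) ≫ m = U.ι ≫ 𝟙 X
    rw [Category.assoc, hr, Category.comp_id]
  · change U.π ≫ coprod.inr ≫ pushout.inr _ _ = (coprod.inr ≫ e) ≫ pushout.inl _ _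
    simp [pushout.condition]
  · rintro V ⟨g, h, hg, hh⟩ ⟨g', h', hg', hh'⟩
    obtain ⟨d, hd, hd'⟩ := hC.exists_lift e V.ι (coprod.desc g g') m he inferInstance (by
      rw [hf]; ext <;> simp [hg, hg'])
    have hw : e ≫ d ≫ V.π = coprod.map S.π U.π ≫ coprod.desc h h' := by
      rw [reassoc_of% hd]
      ext <;> simp [hh, hh']
    exact ⟨d, hp.desc (d ≫ V.π) (coprod.desc h h') hw, by simpa using hd', hp.inl_desc _ _ _⟩

/-- The product of the two quotients need not be subinitial. The intersection of the subobjects is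
therefore cut down to the part mapped into the image `N` of the initial object in that product;
morphisms from subinitial objects land in `N` anyway. -/
theorem exists_inf [HasInitial C] [HasPullbacks C] [HasBinaryProducts C]
    (hC : EpiMonoFactorizations C) {X : C}
    (S U : Subquotient X) : ∃ J : Subquotient X, Rel (𝟙 X) J S ∧ Rel (𝟙 X) J U ∧
      ∀ V, Rel (𝟙 X) V S → Rel (𝟙 X) V U → Rel (𝟙 X) V J := by
  obtain ⟨N, e, n, he, hn, hf⟩ := hC.exists_fac (initial.to (S.quo ⨯ U.quo))
  have hN : Subinitial N := (Subinitial.of_isInitial initialIsInitial).of_epi e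
  have hD := IsPullback.of_hasPullback S.ι U.ι
  generalize hp : pullback.fst S.ι U.ι = p at hD
  generalize hq : pullback.snd S.ι U.ι = q at hD
  have : Mono p := hp ▸ inferInstance
  have hk := IsPullback.of_hasPullback (prod.lift (p ≫ S.π) (q ≫ U.π)) n
  have hk₁ := hk.w =≫ prod.fst
  have hk₂ := hk.w =≫ prod.snd
  simp only [Category.assoc, prod.lift_fst, prod.lift_snd] at hk₁ hk₂
  refine ⟨⟨_, N, pullback.fst _ n ≫ p ≫ S.ι, pullback.snd (prod.lift (p ≫ S.π) (q ≫ U.π)) n,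
    inferInstance, hN⟩, ⟨pullback.fst _ n ≫ p, n ≫ prod.fst, ?_, ?_⟩,
    ⟨pullback.fst _ n ≫ q, n ≫ prod.snd, ?_, ?_⟩, ?_⟩
  · exact (Category.assoc _ _ _).trans (Category.comp_id _).symm
  · exact hk₁.symm.trans (Category.assoc _ _ _).symm
  · change (pullback.fst _ n ≫ q) ≫ U.ι = (pullback.fst _ n ≫ p ≫ S.ι) ≫ 𝟙 X
    simp [hD.w]
  · exact hk₂.symm.trans (Category.assoc _ _ _).symm
  · rintro V ⟨g, h, hg, hh⟩ ⟨g', h', hg', hh'⟩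
    obtain ⟨t, ht⟩ := exists_lift_bot hC n V.subinitial (prod.lift h h')
    have hw : hD.lift g g' (by rw [hg, hg']) ≫ prod.lift (p ≫ S.π) (q ≫ U.π) =
        (V.π ≫ t) ≫ n := by
      ext <;> simp [ht, hh, hh']
    refine ⟨hk.lift _ _ hw, t, ?_, ?_⟩
    · change hk.lift _ _ hw ≫ pullback.fst _ n ≫ p ≫ S.ι = _
      simp [hg]
    · exact (hk.lift_snd _ _ hw).symm

end Subquotient

namespace Subquotient

variable {C : Type u} [Category.{v} C]

theorem rel_comap_mapMono [HasPullbacks C] {X Y : C} (m : X ⟶ Y) [Mono m] (S : Subquotient X) :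
    Rel (𝟙 X) (comap m (mapMono m S)) S := by
  have h : pullback.snd m (S.ι ≫ m) ≫ S.ι = pullback.fst m (S.ι ≫ m) := by
    rw [← cancel_mono m, Category.assoc, pullback.condition]
  exact ⟨pullback.snd m (S.ι ≫ m), 𝟙 S.quo, h.trans (Category.comp_id _).symm,
    Category.comp_id _⟩

/-- This makes direct images of subquotients with terminal quotient again of that kind. -/
theorem isPushout_terminal [HasTerminal C] {X W : C} (e : X ⟶ W) [Epi e] :
    IsPushout e (terminal.from X) (terminal.from W) (𝟙 (⊤_ C)) := by
  refine IsPushout.of_isColimit' ⟨terminalIsTerminal.hom_ext _ _⟩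
    (PushoutCocone.IsColimit.mk _ (fun s => s.inr) (fun s => ?_)
      (fun s => Category.id_comp _) (fun s m _ hm => ?_))
  · rw [← cancel_epi e, s.condition, ← Category.assoc]
    congr 1
    exact terminalIsTerminal.hom_ext _ _
  · exact (Category.id_comp m).symm.trans hm

section ker

variable [HasInitial C] [HasPullbacks C] (hC : EpiMonoFactorizations C)

theorem rel_ker_iff_comp {X Y Z : C} {f : X ⟶ Y} {g : Y ⟶ Z} {S : Subquotient X} :
    Rel f S (ker hC g) ↔ Rel (𝟙 X) S (ker hC (f ≫ g)) := by
  rw [ker, ker, rel_comp_iff, rel_comap_iff]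

variable [HasPushouts C]

/-- The smallest kernel above a subquotient. -/
noncomputable def normalClosure {X : C} (S : Subquotient X) : Subquotient X :=
  ker hC (pushout.inl S.ι S.π)

theorem rel_normalClosure {X : C} (S : Subquotient X) : Rel (𝟙 X) S (normalClosure hC S) :=
  (rel_ker_iff hC).2 ⟨pushout.inr S.ι S.π, pushout.condition.symm⟩

/-- A morphism whose kernel contains `S` factors through the pushout defining the closure. -/
theorem normalClosure_rel_ker_iff {X Y : C} {f : X ⟶ Y} {S : Subquotient X} :
    Rel (𝟙 X) (normalClosure hC S) (ker hC f) ↔ Rel (𝟙 X) S (ker hC f) := by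
  constructor
  · intro h
    simpa using (rel_normalClosure hC S).comp h
  · rw [rel_ker_iff]
    rintro ⟨t, ht⟩
    obtain ⟨s, hs⟩ := (rel_ker_iff hC).1 (Rel.refl (normalClosure hC S))
    rw [rel_ker_iff]
    refine ⟨s ≫ pushout.desc f t ht.symm, ?_⟩
    rw [reassoc_of% hs, pushout.inl_desc]

theorem Rel.normalClosure {X Y : C} {f : X ⟶ Y} {S : Subquotient X} {U : Subquotient Y}
    (h : Rel f S U) : Rel f (normalClosure hC S) (normalClosure hC U) := by
  have h1 : Rel f S (Subquotient.normalClosure hC U) := by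
    simpa using h.comp (rel_normalClosure hC U)
  unfold Subquotient.normalClosure at h1 ⊢
  rw [rel_ker_iff_comp] at h1 ⊢
  exact (normalClosure_rel_ker_iff hC).2 h1

end ker

/-! ### A criterion for the subquotients to form an emd-noetherian form. -/

/-- The conditions under which the subquotients form an emd-noetherian form. -/
structure IsNoetherian [HasFiniteColimits C] [HasTerminal C] [HasPullbacks C]
    (hC : EpiMonoFactorizations C) : Prop where
  subinitial_terminal : Subinitial (⊤_ C)
  exists_comp_eq : ∀ {X Y Z : C} (e : X ⟶ Y) (f : X ⟶ Z), Epi e →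
    Rel (𝟙 X) (ker hC e) (ker hC f) → ∃ t, e ≫ t = f
  -- Joins are expressed by testing against upper bounds `U`, so no choice of join is needed. Only
  -- epimorphisms `e` occur, since the monomorphic parts of factorizations cause no restriction.
  comap_map : ∀ {X Y : C} (e : X ⟶ Y) (S U : Subquotient X) (V : Subquotient Y), Epi e →
    IsMap e S V → Rel (𝟙 X) S U → Rel (𝟙 X) (ker hC e) U → Rel (𝟙 X) (comap e V) U
  map_comap : ∀ {X Y : C} (e : X ⟶ Y) (V W : Subquotient Y), Epi e →
    Rel e (comap e V) W → Rel (𝟙 Y) V W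
  ker_pushout : ∀ {X Y Z W : C} {x : X ⟶ Y} {y : X ⟶ Z} {x' : Y ⟶ W} {y' : Z ⟶ W}
    (U : Subquotient X), Epi x → Epi y → IsPushout x y x' y' →
    Rel (𝟙 X) (ker hC x) U → Rel (𝟙 X) (ker hC y) U → Rel (𝟙 X) (ker hC (x ≫ x')) U
  mono_pushout : ∀ {A X Q Y : C} {a : A ⟶ X} {q : A ⟶ Q} {x : X ⟶ Y} {y : Q ⟶ Y},
    Subinitial Q → Mono a → IsPushout a q x y → Mono y

/-- `P` is the system of subquotients up to isomorphism, with `mk` assigning to a subquotient its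
isomorphism class. -/
structure Represents (P : ClusterSystem.{w} C) (mk : ∀ ⦃X : C⦄, Subquotient X → P.Cluster X) :
    Prop where
  surjective : ∀ {X : C} (s : P.Cluster X), ∃ S, mk S = s
  rel_iff : ∀ {X Y : C} {f : X ⟶ Y} {S : Subquotient X} {U : Subquotient Y},
    P.rel f (mk S) (mk U) ↔ Rel f S U

namespace Represents

variable {P : ClusterSystem.{w} C} {mk : ∀ ⦃X : C⦄, Subquotient X → P.Cluster X}
  (hR : Represents P mk)
include hR

theorem le_iff {X : C} {S U : Subquotient X} : mk S ≤ mk U ↔ Rel (𝟙 X) S U := hR.rel_iff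

theorem isDirectImage_mk (hC : EpiMonoFactorizations C) {X Y : C} {f : X ⟶ Y} {S : Subquotient X}
    {V : Subquotient Y} (hV : IsMap f S V) : P.IsDirectImage f (mk S) (mk V) := by
  refine ⟨hR.rel_iff.2 hV.rel, fun U hU => ?_⟩
  obtain ⟨U, rfl⟩ := hR.surjective U
  exact hR.le_iff.2 (hV.rel_of_rel hC (hR.rel_iff.1 hU))

theorem isInverseImage_mk [HasPullbacks C] {X Y : C} (f : X ⟶ Y) (U : Subquotient Y) :
    P.IsInverseImage f (mk U) (mk (comap f U)) := by
  refine ⟨hR.rel_iff.2 (rel_comap f U), fun V hV => ?_⟩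
  obtain ⟨V, rfl⟩ := hR.surjective V
  exact hR.le_iff.2 (rel_comap_iff.2 (hR.rel_iff.1 hV))

variable [HasFiniteColimits C] [HasTerminal C] [HasPullbacks C] (hC : EpiMonoFactorizations C)

theorem isBot_mk (X : C) : IsBot (mk (bot hC X)) := fun S => by
  obtain ⟨S, rfl⟩ := hR.surjective S
  exact hR.le_iff.2 (bot_rel hC _ S)

theorem isTop_mk (hT : Subinitial (⊤_ C)) (X : C) : IsTop (mk (ofMono hT (𝟙 X))) := fun S => by
  obtain ⟨S, rfl⟩ := hR.surjective S
  exact hR.le_iff.2 ((rel_ofMono_iff hT).2 ⟨S.ι, rfl⟩)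

include hC

theorem isOrean (hT : Subinitial (⊤_ C)) : P.IsOrean where
  exists_bot X := ⟨_, hR.isBot_mk hC X⟩
  exists_top X := ⟨_, hR.isTop_mk hT X⟩
  exists_sup {X} A B := by
    obtain ⟨A, rfl⟩ := hR.surjective A
    obtain ⟨B, rfl⟩ := hR.surjective B
    obtain ⟨J, hA, hB, hJ⟩ := exists_sup hC A B
    refine ⟨mk J, ?_, fun U hU => ?_⟩
    · rintro U (rfl | rfl)
      exacts [hR.le_iff.2 hA, hR.le_iff.2 hB]
    · obtain ⟨U, rfl⟩ := hR.surjective U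
      exact hR.le_iff.2 (hJ U (hR.le_iff.1 (hU (by simp))) (hR.le_iff.1 (hU (by simp))))
  exists_inf {X} A B := by
    have := hasBinaryProducts_of_hasTerminal_and_pullbacks C
    obtain ⟨A, rfl⟩ := hR.surjective A
    obtain ⟨B, rfl⟩ := hR.surjective B
    obtain ⟨J, hA, hB, hJ⟩ := exists_inf hC A B
    refine ⟨mk J, ?_, fun U hU => ?_⟩
    · rintro U (rfl | rfl)
      exacts [hR.le_iff.2 hA, hR.le_iff.2 hB]
    · obtain ⟨U, rfl⟩ := hR.surjective U
      exact hR.le_iff.2 (hJ U (hR.le_iff.1 (hU (by simp))) (hR.le_iff.1 (hU (by simp))))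
  exists_between f g A D hAD := by
    obtain ⟨A, rfl⟩ := hR.surjective A
    obtain ⟨D, rfl⟩ := hR.surjective D
    exact ⟨mk (comap g D), hR.rel_iff.2 (rel_comp_iff.2 (hR.rel_iff.1 hAD)),
      hR.rel_iff.2 (rel_comap g D)⟩
  exists_directImage f S := by
    obtain ⟨S, rfl⟩ := hR.surjective S
    obtain ⟨V, hV⟩ := exists_isMap hC f S
    exact ⟨mk V, hR.isDirectImage_mk hC hV⟩
  exists_inverseImage f T := by
    obtain ⟨T, rfl⟩ := hR.surjective T
    exact ⟨_, hR.isInverseImage_mk f T⟩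

variable (h : P.IsOrean)

omit [HasFiniteColimits C] [HasTerminal C] [HasPullbacks C] in
theorem dir_mk {X Y : C} {f : X ⟶ Y} {S : Subquotient X} {V : Subquotient Y}
    (hV : IsMap f S V) : h.dir f (mk S) = mk V :=
  (h.isDirectImage_iff.1 (hR.isDirectImage_mk hC hV)).symm

omit [HasFiniteColimits C] [HasTerminal C] hC in
theorem inv_mk {X Y : C} (f : X ⟶ Y) (U : Subquotient Y) : h.inv f (mk U) = mk (comap f U) :=
  (h.isInverseImage_iff.1 (hR.isInverseImage_mk f U)).symm

theorem ker_eq {X Y : C} (f : X ⟶ Y) : h.ker f = mk (ker hC f) := by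
  rw [ClusterSystem.IsOrean.ker, ← h.isBot_iff.1 (hR.isBot_mk hC Y), hR.inv_mk]
  rfl

theorem im_eq (hT : Subinitial (⊤_ C)) {X Y W : C} (e : X ⟶ W) (m : W ⟶ Y) [he : Epi e]
    [Mono m] : h.im (e ≫ m) = mk (ofMono hT m) := by
  rw [ClusterSystem.IsOrean.im, ← h.isTop_iff.1 (hR.isTop_mk hT X)]
  exact hR.dir_mk hC h ⟨e, 𝟙 (⊤_ C), he, (Category.id_comp _).symm, isPushout_terminal e⟩

theorem inv_dir_of_mono {X Y : C} (m : X ⟶ Y) [Mono m] (s : P.Cluster X) :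
    h.inv m (h.dir m s) = s := by
  obtain ⟨S, rfl⟩ := hR.surjective s
  rw [hR.dir_mk hC h (isMap_mapMono m S), hR.inv_mk]
  refine le_antisymm (hR.le_iff.2 (rel_comap_mapMono m S)) ?_
  rw [hR.le_iff, rel_comap_iff]
  exact (isMap_mapMono m S).rel

theorem ker_comp_mono {X Y Z : C} (f : X ⟶ Y) (m : Y ⟶ Z) [Mono m] :
    h.ker (f ≫ m) = h.ker f := by
  rw [h.ker_comp, ClusterSystem.IsOrean.ker, ClusterSystem.IsOrean.ker, ← h.dir_bot m,
    hR.inv_dir_of_mono hC]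

/-- A subquotient below both `t` and the subobject `m` has a domain that maps into the pullback of
`m` and the inclusion of `t`. -/
theorem isGLB_dir_inv_of_mono (hT : Subinitial (⊤_ C)) {X Y : C} (m : X ⟶ Y) [Mono m]
    (t : P.Cluster Y) : IsGLB {t, mk (ofMono hT m)} (h.dir m (h.inv m t)) := by
  obtain ⟨U, rfl⟩ := hR.surjective t
  rw [hR.inv_mk, hR.dir_mk hC h (isMap_mapMono m _)]
  refine ⟨?_, fun V hV => ?_⟩
  · rintro V (rfl | rfl)
    · exact hR.le_iff.2 ((isMap_mapMono m _).rel_of_rel hC (rel_comap m U))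
    · exact hR.le_iff.2 ((rel_ofMono_iff hT).2
        ⟨pullback.fst m U.ι, (Category.comp_id _).symm⟩)
  · obtain ⟨V, rfl⟩ := hR.surjective V
    obtain ⟨g, k, hg, hk⟩ := hR.le_iff.1 (hV (Set.mem_insert _ _))
    obtain ⟨g', hg'⟩ := (rel_ofMono_iff hT).1 (hR.le_iff.1 (hV (Set.mem_insert_of_mem _ rfl)))
    refine hR.le_iff.2 ⟨pullback.lift g' g (by rw [hg, hg']), k, ?_, ?_⟩
    · exact (pullback.lift_fst_assoc _ _ _ _).trans hg'
    · exact hk.trans (pullback.lift_snd_assoc _ _ _ _).symm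

variable {hC}

theorem isNoetherian (hS : IsNoetherian hC) : P.IsNoetherian := by
  have h := hR.isOrean hC hS.subinitial_terminal
  have hT := hS.subinitial_terminal
  refine ⟨h, ?_, ?_, ?_, ?_, ?_⟩
  · intro X Y f S T U K hT' hU hK
    rw [h.isDirectImage_iff] at hT'
    rw [h.isInverseImage_iff] at hU
    rw [h.isKernel_iff] at hK
    subst hT' hU hK
    -- The monomorphic part affects neither side of the identity, leaving the case of an
    -- epimorphism.
    obtain ⟨W, e, m, he, hm, rfl⟩ := hC.exists_fac f
    rw [h.dir_comp, h.inv_comp, hR.inv_dir_of_mono hC, hR.ker_comp_mono hC]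
    refine ⟨?_, fun U hU => ?_⟩
    · rintro U (rfl | rfl)
      · exact h.le_inv_iff.2 (h.rel_dir e _)
      · exact h.inv_mono e (h.bot_le _)
    · obtain ⟨S, rfl⟩ := hR.surjective S
      obtain ⟨U, rfl⟩ := hR.surjective U
      obtain ⟨V, hV⟩ := exists_isMap hC e S
      have h1 := hU (Set.mem_insert _ _)
      have h2 := hU (Set.mem_insert_of_mem _ rfl)
      rw [hR.ker_eq hC] at h2
      rw [hR.dir_mk hC h hV, hR.inv_mk]
      exact hR.le_iff.2 (hS.comap_map e S U V he hV (hR.le_iff.1 h1) (hR.le_iff.1 h2))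
  · intro X Y f T S U I hS' hU hI
    rw [h.isInverseImage_iff] at hS'
    rw [h.isImage_iff] at hI
    subst hS' hI
    rw [h.isDirectImage_iff] at hU
    subst hU
    obtain ⟨W, e, m, he, hm, rfl⟩ := hC.exists_fac f
    have key : ∀ t, h.dir e (h.inv e t) = t := by
      intro t
      refine le_antisymm (h.dir_le_iff.2 (h.rel_inv e t)) ?_
      obtain ⟨V, rfl⟩ := hR.surjective t
      have := h.rel_dir e (h.inv e (mk V))
      obtain ⟨W, hW⟩ := hR.surjective (h.dir e (h.inv e (mk V)))
      rw [← hW, hR.inv_mk, hR.rel_iff] at this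
      rw [← hW]
      exact hR.le_iff.2 (hS.map_comap e V W he this)
    rw [h.dir_comp, h.inv_comp, key, hR.im_eq hC h hT]
    exact hR.isGLB_dir_inv_of_mono hC h hT m T
  · intro X Y f
    obtain ⟨W, e, m, he, hm, rfl⟩ := hC.exists_fac f
    refine ⟨W, e, m, h.ker e, h.im m, h.isKernel_iff.2 (hR.ker_comp_mono hC h e m).symm,
      h.isImage_iff.2 ?_, ⟨h.isKernel_iff.2 rfl, ?_⟩, ⟨h.isImage_iff.2 rfl, ?_⟩, rfl⟩
    · rw [hR.im_eq hC h hT, ← hR.im_eq hC h hT (𝟙 W), Category.id_comp]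
    · intro Z e' K hK hle
      rw [h.isKernel_iff] at hK
      subst hK
      rw [hR.ker_eq hC, hR.ker_eq hC] at hle
      obtain ⟨t, ht⟩ := hS.exists_comp_eq e e' he (hR.le_iff.1 hle)
      exact ⟨t, ht, fun s hs => by rw [← cancel_epi e, ht, hs]⟩
    · intro Z m' I hI hle
      rw [h.isImage_iff] at hI
      subst hI
      have h1 : h.im m = mk (ofMono hT m) := by
        rw [← hR.im_eq hC h hT (𝟙 W), Category.id_comp]
      rw [h1, ClusterSystem.IsOrean.im, h.dir_le_iff, ← h.isTop_iff.1 (hR.isTop_mk hT Z), hR.rel_iff,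
        rel_ofMono_iff] at hle
      obtain ⟨g, hg⟩ := hle
      have hg : g ≫ m = m' := hg.trans (Category.id_comp _)
      exact ⟨g, hg, fun s hs => (cancel_mono m).1 (hs.trans hg.symm)⟩
  · rintro X A B S ⟨Y, f, hf⟩ ⟨Z, g, hg⟩ hAB
    rw [h.isKernel_iff] at hf hg
    subst hf hg
    -- Passing to epimorphic parts keeps the kernels; their join is then the kernel of the diagonal
    -- of the pushout.
    obtain ⟨Y, f, m, hf, hm, rfl⟩ := hC.exists_fac f
    obtain ⟨Z, g, n, hg, hn, rfl⟩ := hC.exists_fac g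
    rw [hR.ker_comp_mono hC, hR.ker_comp_mono hC] at hAB
    have hp := IsPushout.of_hasPushout f g
    refine ⟨_, f ≫ pushout.inl f g, h.isKernel_iff.2 (hAB.unique ⟨?_, fun U hU => ?_⟩)⟩
    · rintro U (rfl | rfl)
      · exact h.ker_le_comp _ _
      · rw [hp.w]
        exact h.ker_le_comp _ _
    · have h1 := hU (Set.mem_insert _ _)
      have h2 := hU (Set.mem_insert_of_mem _ rfl)
      obtain ⟨U, rfl⟩ := hR.surjective U
      rw [hR.ker_eq hC, hR.le_iff] at h1 h2 ⊢
      exact hS.ker_pushout U hf hg hp h1 h2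
  · rintro X A B S ⟨Y, f, hf⟩ ⟨Z, g, hg⟩ hAB
    rw [h.isImage_iff] at hf hg
    subst hf hg
    obtain ⟨Y, e, f, he, hf, rfl⟩ := hC.exists_fac f
    obtain ⟨Z, e', g, he', hg, rfl⟩ := hC.exists_fac g
    rw [hR.im_eq hC h hT, hR.im_eq hC h hT] at hAB
    have him : h.im (pullback.fst f g ≫ f) = mk (ofMono hT (pullback.fst f g ≫ f)) := by
      rw [← hR.im_eq hC h hT (𝟙 _), Category.id_comp]
    refine ⟨_, pullback.fst f g ≫ f, h.isImage_iff.2 (hAB.unique ?_)⟩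
    rw [him]
    refine ⟨?_, fun U hU => ?_⟩
    · rintro U (rfl | rfl)
      · rw [hR.le_iff, rel_ofMono_iff]
        exact ⟨pullback.fst f g, (Category.comp_id _).symm⟩
      · rw [hR.le_iff, rel_ofMono_iff]
        exact ⟨pullback.snd f g, pullback.condition.symm.trans (Category.comp_id _).symm⟩
    · have h1 := hU (Set.mem_insert _ _)
      have h2 := hU (Set.mem_insert_of_mem _ rfl)
      obtain ⟨U, rfl⟩ := hR.surjective U
      rw [hR.le_iff, rel_ofMono_iff] at h1 h2 ⊢
      obtain ⟨s, hs⟩ := h1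
      obtain ⟨t, ht⟩ := h2
      exact ⟨pullback.lift s t (by rw [hs, ht]),
        (pullback.lift_fst_assoc _ _ _ _).trans hs⟩

omit [HasFiniteColimits C] [HasTerminal C] [HasPullbacks C] hC in
/-- A monotone operation on subquotients descends to the clusters represented by them. -/
theorem exists_operator (k : ∀ {X : C}, Subquotient X → Subquotient X)
    (hk : ∀ {X Y : C} {f : X ⟶ Y} {S : Subquotient X} {U : Subquotient Y},
      Rel f S U → Rel f (k S) (k U)) :
    ∃ κ : P.Operator P, ∀ {X : C} (S : Subquotient X), κ.toFun (mk S) = mk (k S) := by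
  let κ : P.Operator P :=
    { toFun := fun s => mk (k (hR.surjective s).choose)
      monotone := fun f A B hAB => by
        rw [hR.rel_iff]
        apply hk
        rwa [← hR.rel_iff, (hR.surjective A).choose_spec, (hR.surjective B).choose_spec] }
  refine ⟨κ, fun {X} S => ?_⟩
  have hS := (hR.surjective (mk S)).choose_spec
  refine le_antisymm (hR.le_iff.2 (hk ?_)) (hR.le_iff.2 (hk ?_))
  · exact hR.le_iff.1 hS.le
  · exact hR.le_iff.1 hS.ge

theorem isEmdNoetherian (hS : IsNoetherian hC) : P.IsEmdNoetherian := by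
  have h := hR.isOrean hC hS.subinitial_terminal
  have hT := hS.subinitial_terminal
  refine ⟨hR.isNoetherian hS, ?_⟩
  obtain ⟨κs, hs⟩ := hR.exists_operator (fun S => sat hT S) (by
    rintro X Y f S U ⟨g, -, hg, -⟩
    exact (rel_sat_iff hT).2 ⟨g, hg⟩)
  obtain ⟨κe, he⟩ := hR.exists_operator (fun S => normalClosure hC S)
    (fun hSU => hSU.normalClosure hC)
  have im_eq : ∀ {X Y : C} (f : X ⟶ Y), ∃ (W : C) (m : W ⟶ Y) (_ : Mono m),
      h.im f = mk (ofMono hT m) := by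
    intro X Y f
    obtain ⟨W, e, m, he, hm, rfl⟩ := hC.exists_fac f
    exact ⟨W, m, hm, hR.im_eq hC h hT e m⟩
  refine ⟨κs, κe, ClusterSystem.isExactMeetDecomposition_of_closure h ?_ ?_ ?_ ?_ ?_ ?_ ?_ ?_⟩
  · intro X s
    obtain ⟨S, rfl⟩ := hR.surjective s
    rw [hs, hs]
    exact le_antisymm (hR.le_iff.2 ((rel_sat_iff hT).2
        ⟨𝟙 S.dom, (Category.id_comp _).trans (Category.comp_id _).symm⟩))
      (hR.le_iff.2 ((rel_sat_iff hT).2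
        ⟨𝟙 S.dom, (Category.id_comp _).trans (Category.comp_id _).symm⟩))
  · intro X s
    obtain ⟨S, rfl⟩ := hR.surjective s
    rw [he, he]
    refine le_antisymm (hR.le_iff.2 ((normalClosure_rel_ker_iff hC).2 (Rel.refl _)))
      (hR.le_iff.2 (rel_normalClosure hC _))
  · intro X s
    obtain ⟨S, rfl⟩ := hR.surjective s
    rw [hs, he]
    refine ⟨?_, fun U hU => ?_⟩
    · rintro U (rfl | rfl)
      · exact hR.le_iff.2 ((rel_sat_iff hT).2 ⟨𝟙 S.dom, by simp⟩)
      · exact hR.le_iff.2 (rel_normalClosure hC _)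
    · obtain ⟨U, rfl⟩ := hR.surjective U
      obtain ⟨g, hg⟩ := (rel_sat_iff hT).1 (hR.le_iff.1 (hU (Set.mem_insert _ _)))
      obtain ⟨k, hk⟩ := (rel_ker_iff hC).1 (hR.le_iff.1 (hU (Set.mem_insert_of_mem _ rfl)))
      -- A subquotient `U` below both closures has a morphism `k` from its quotient into the
      -- pushout. As `S.quo` is a subobject of the pushout, `k` lifts to `S.quo` by orthogonality.
      have := hS.mono_pushout S.subinitial S.mono_ι (IsPushout.of_hasPushout S.ι S.π)
      obtain ⟨t, ht⟩ := exists_lift_bot hC (pushout.inr S.ι S.π) U.subinitial k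
      refine hR.le_iff.2 ⟨g, t, hg, ?_⟩
      rw [← cancel_mono (pushout.inr S.ι S.π), Category.assoc, ht, hk, Category.assoc,
        ← pushout.condition, reassoc_of% hg]
  · intro X s hfix
    obtain ⟨S, rfl⟩ := hR.surjective s
    refine ⟨_, S.ι, h.isImage_iff.2 ?_⟩
    rw [← Category.id_comp S.ι, hR.im_eq hC h hT, ← hfix, hs]
    rfl
  · intro X s hfix
    obtain ⟨S, rfl⟩ := hR.surjective s
    refine ⟨_, pushout.inl S.ι S.π, h.isKernel_iff.2 ?_⟩
    rw [hR.ker_eq hC, ← hfix, he]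
    rfl
  · intro X Y f
    obtain ⟨W, m, hm, hf⟩ := im_eq f
    rw [hf, hs]
    rfl
  · intro X Y f
    rw [hR.ker_eq hC, he]
    exact le_antisymm (hR.le_iff.2 ((normalClosure_rel_ker_iff hC).2 (Rel.refl _)))
      (hR.le_iff.2 (rel_normalClosure hC _))
  · intro X Y f
    rw [hR.ker_eq hC, hs, ← h.isBot_iff.1 (hR.isBot_mk hC Y), hs, hR.inv_mk]
    -- Both sides have the pullback of `f` along the bottom subobject as domain and the terminal
    -- object as quotient.
    refine le_antisymm (hR.le_iff.2 (rel_comap_iff.2 ((rel_sat_iff hT).2 ?_)))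
      (hR.le_iff.2 ((rel_sat_iff hT).2 ?_))
    · exact ⟨pullback.snd f (bot hC Y).ι, pullback.condition.symm⟩
    · exact ⟨𝟙 (pullback f (bot hC Y).ι), (Category.id_comp _).trans (Category.comp_id _).symm⟩

end Represents

end Subquotient

/-! ## The total category of a cluster system -/

namespace ClusterSystem

variable {C : Type u} [Category.{v} C] (P : ClusterSystem.{w} C)

/-- The category of pairs of an object and a cluster in it. -/
structure Total where
  /-- the object -/
  base : C
  /-- the cluster -/
  cluster : P.Cluster base

instance : Category.{v} P.Total where
  Hom A B := {f : A.base ⟶ B.base // P.rel f A.cluster B.cluster}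
  id _ := ⟨𝟙 _, P.rel_id _⟩
  comp f g := ⟨f.1 ≫ g.1, P.rel_comp _ _ _ _ _ f.2 g.2⟩
  id_comp _ := Subtype.ext (Category.id_comp _)
  comp_id _ := Subtype.ext (Category.comp_id _)
  assoc _ _ _ := Subtype.ext (Category.assoc _ _ _)

/-- The functor that forgets the clusters. -/
def Total.forget : P.Total ⥤ C where
  obj A := A.base
  map f := f.1

theorem Total.isForm_forget : IsForm (Total.forget P) where
  faithful := ⟨fun h => Subtype.ext h⟩
  amnestic := by
    rintro ⟨X, S⟩ ⟨X', S'⟩ φ hφ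
    replace hφ : (Total.forget P).IsHomLift (𝟙 X) φ.hom := hφ
    have hX : X' = X := IsHomLift.codomain_eq (Total.forget P) (𝟙 X) φ.hom
    subst hX
    have h1 : φ.hom.1 = 𝟙 X' := by
      have h := IsHomLift.fac' (Total.forget P) (𝟙 X') φ.hom
      exact h.trans ((Category.id_comp _).trans (Category.comp_id _))
    have h2 : φ.inv.1 = 𝟙 X' := by
      have : φ.hom.1 ≫ φ.inv.1 = 𝟙 X' := congrArg Subtype.val φ.hom_inv_id
      rwa [h1, Category.id_comp] at this
    have hS : S = S' := P.rel_antisymm S S' (h1 ▸ φ.hom.2) (h2 ▸ φ.inv.2)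
    subst hS
    exact ⟨rfl, Subtype.ext h1⟩

/-- A cluster as an element of the fiber. -/
def Total.ofCluster {X : C} (S : P.Cluster X) : (Total.forget P).Fiber X := ⟨⟨X, S⟩, rfl⟩

theorem Total.exists_ofCluster_eq {X : C} (S : (Total.forget P).Fiber X) :
    ∃ S', Total.ofCluster P S' = S := by
  obtain ⟨⟨X', S⟩, rfl⟩ := S
  exact ⟨S, rfl⟩

theorem Total.rel_iff {X Y : C} {f : X ⟶ Y} {S : P.Cluster X} {U : P.Cluster Y} :
    (Total.isForm_forget P).clusters.rel f (Total.ofCluster P S) (Total.ofCluster P U) ↔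
      P.rel f S U := by
  constructor
  · rintro ⟨φ, hφ⟩
    have h := IsHomLift.fac' (Total.forget P) f φ
    have h1 : φ.1 = f := h.trans ((Category.id_comp _).trans (Category.comp_id _))
    exact h1 ▸ φ.2
  · intro h
    let φ : (Total.ofCluster P S).1 ⟶ (Total.ofCluster P U).1 := ⟨f, h⟩
    exact ⟨φ, inferInstanceAs ((Total.forget P).IsHomLift ((Total.forget P).map φ) φ)⟩

/-- The system of those clusters in the objects `T.obj X` which satisfy a predicate. -/
def restrict {C' : Type u₂} [Category.{v₂} C'] (P : ClusterSystem.{w'} C') (T : C ⥤ C')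
    (p : ∀ X : C, P.Cluster (T.obj X) → Prop) [∀ X', Small.{w} (P.Cluster X')] :
    ClusterSystem.{w} C where
  Cluster X := {s : Shrink.{w} (P.Cluster (T.obj X)) // p X ((equivShrink _).symm s)}
  rel f A B := P.rel (T.map f) ((equivShrink _).symm A.1) ((equivShrink _).symm B.1)
  rel_id S := by
    rw [T.map_id]
    exact P.rel_id _
  rel_comp f g _ _ _ h h' := by
    rw [T.map_comp]
    exact P.rel_comp _ _ _ _ _ h h'
  rel_antisymm {X} S T' h h' := by
    rw [T.map_id] at h h'
    exact Subtype.ext ((equivShrink _).symm.injective (P.rel_antisymm _ _ h h'))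

end ClusterSystem

theorem hasEmdNoetherianForm_of_represents {C : Type u} [Category.{v} C] [HasFiniteColimits C]
    [HasTerminal C] [HasPullbacks C] {hC : EpiMonoFactorizations C}
    (hS : Subquotient.IsNoetherian hC) {P : ClusterSystem.{w} C}
    {mk : ∀ ⦃X : C⦄, Subquotient X → P.Cluster X} (hR : Subquotient.Represents P mk) :
    HasEmdNoetherianForm.{w} C := by
  refine ⟨P.Total, inferInstance, ClusterSystem.Total.forget P,
    ClusterSystem.Total.isForm_forget P, fun X => ?_, ?_⟩
  · exact small_of_surjective (f := ClusterSystem.Total.ofCluster P (X := X))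
      (ClusterSystem.Total.exists_ofCluster_eq P)
  · refine Subquotient.Represents.isEmdNoetherian
      (mk := fun X S => ClusterSystem.Total.ofCluster P (mk S)) ⟨fun {X} s => ?_, ?_⟩ hS
    · obtain ⟨s, rfl⟩ := ClusterSystem.Total.exists_ofCluster_eq P s
      obtain ⟨S, rfl⟩ := hR.surjective s
      exact ⟨S, rfl⟩
    · intro X Y f S U
      rw [← hR.rel_iff]
      exact ClusterSystem.Total.rel_iff P

/-! ## Transfer along a functor -/

section Transfer

variable {C : Type u₁} [Category.{v₁} C] {C' : Type u₂} [Category.{v₂} C'] (T : C ⥤ C')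
  [T.Faithful] [HasFiniteColimits C] [PreservesFiniteColimits T] [Balanced C]

/-- In the join `J` of the image of `x` with `B`, the inclusion of `B` becomes epi under `T`,
because `t` carries the part coming from `A` into `T.obj B`. Faithfulness reflects this, and
balancedness makes the inclusion invertible. -/
theorem exists_comp_eq_of_map_mono (hC : EpiMonoFactorizations C) [T.PreservesMonomorphisms]
    {A B Y : C} {x : A ⟶ Y} {b : B ⟶ Y} [Mono b] {t : T.obj A ⟶ T.obj B}
    (ht : t ≫ T.map b = T.map x) : ∃ g, g ≫ b = x := by
  obtain ⟨J, p, j, hp, hj, hf⟩ := hC.exists_fac (coprod.desc x b)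
  have hx : (coprod.inl ≫ p) ≫ j = x := by rw [Category.assoc, hf, coprod.inl_desc]
  have hb : (coprod.inr ≫ p) ≫ j = b := by rw [Category.assoc, hf, coprod.inr_desc]
  have hx' : t ≫ T.map (coprod.inr ≫ p) = T.map (coprod.inl ≫ p) := by
    rw [← cancel_mono (T.map j), Category.assoc, ← T.map_comp, hb, ← T.map_comp, hx, ht]
  have hepi : Epi (T.map (coprod.inr ≫ p : B ⟶ J)) := by
    refine ⟨fun u v huv => ?_⟩
    rw [← cancel_epi (T.map p)]
    refine BinaryCofan.IsColimit.hom_ext (isColimitOfHasBinaryCoproductOfPreservesColimit T A B)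
      ?_ ?_
    · change T.map coprod.inl ≫ T.map p ≫ u = T.map coprod.inl ≫ T.map p ≫ v
      rw [← T.map_comp_assoc, ← T.map_comp_assoc, ← hx', Category.assoc, huv, Category.assoc]
    · change T.map coprod.inr ≫ T.map p ≫ u = T.map coprod.inr ≫ T.map p ≫ v
      rw [← T.map_comp_assoc, ← T.map_comp_assoc, huv]
  have : Epi (coprod.inr ≫ p : B ⟶ J) := T.epi_of_epi_map hepi
  have : Mono (coprod.inr ≫ p : B ⟶ J) := mono_of_mono_fac hb
  have := isIso_of_mono_of_epi (coprod.inr ≫ p : B ⟶ J)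
  refine ⟨(coprod.inl ≫ p) ≫ CategoryTheory.inv (coprod.inr ≫ p), ?_⟩
  conv_rhs => rw [← hx]
  rw [Category.assoc]
  congr 1
  rw [IsIso.inv_comp_eq, hb]

/-- The given `t` splits the image under `T` of the pushout of `q` along `x`. That pushout is thus
mono as well as epi, hence invertible. -/
theorem exists_comp_eq_of_map_epi {A B Z : C} {x : A ⟶ Z} {q : A ⟶ B} [Epi q]
    {t : T.obj B ⟶ T.obj Z} (ht : T.map q ≫ t = T.map x) : ∃ g, q ≫ g = x := by
  have hp := IsPushout.of_hasPushout q x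
  have hr : T.map (pushout.inr q x) ≫ (hp.map T).desc t (𝟙 _) (by simpa using ht) = 𝟙 _ :=
    (hp.map T).inr_desc _ _ _
  have : Mono (T.map (pushout.inr q x)) := (SplitMono.mk _ hr).mono
  have : Mono (pushout.inr q x) := T.mono_of_mono_map this
  have := isIso_of_mono_of_epi (pushout.inr q x)
  exact ⟨pushout.inl q x ≫ CategoryTheory.inv (pushout.inr q x), by
    rw [pushout.condition_assoc, IsIso.hom_inv_id, Category.comp_id]⟩

theorem Subinitial.map {Q : C} (hQ : Subinitial Q) : Subinitial (T.obj Q) := by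
  have := hQ.epi (initial.to Q)
  exact (Subinitial.of_isInitial (initialIsInitial.isInitialObj T)).of_epi (T.map (initial.to Q))

namespace Subquotient

variable {P : ClusterSystem.{w} C'}

/-- The cluster in `T.obj X` given by a subquotient of `X`. -/
noncomputable def toCluster (h : P.IsOrean) {X : C} (S : Subquotient X) : P.Cluster (T.obj X) :=
  h.dir (T.map S.ι) (h.ker (T.map S.π))

variable [Balanced C'] {κs κe : P.Operator P} (hd : P.IsExactMeetDecomposition κs κe)
  (hN : P.IsNoetherian) (hC : EpiMonoFactorizations C) [T.PreservesMonomorphisms]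

include hN

theorem Rel.toCluster {X Y : C} {f : X ⟶ Y} {S : Subquotient X} {U : Subquotient Y}
    (h : Rel f S U) : P.rel (T.map f) (S.toCluster T hN.isOrean) (U.toCluster T hN.isOrean) := by
  have hO := hN.isOrean
  obtain ⟨a, b, ha, hb⟩ := h
  rw [← hO.dir_le_iff, Subquotient.toCluster, Subquotient.toCluster, ← hO.dir_comp, ← T.map_comp,
    ← ha, T.map_comp, hO.dir_comp]
  refine hO.dir_mono _ (hO.dir_le_iff.2 (hO.le_inv_iff.1 ?_))
  rw [← hO.ker_comp, ← T.map_comp, ← hb, T.map_comp]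
  exact hO.ker_le_comp _ _

omit [PreservesFiniteColimits T] in
theorem toCluster_bot [HasInitial C] (X : C) :
    (bot hC X).toCluster T hN.isOrean = hN.isOrean.bot (T.obj X) := by
  rw [toCluster, hN.isOrean.ker_eq_bot_of_isIso, hN.isOrean.dir_bot]

theorem toCluster_of_isMap {X Y : C} {f : X ⟶ Y} {S : Subquotient X} {V : Subquotient Y}
    (h : IsMap f S V) :
    V.toCluster T hN.isOrean = hN.isOrean.dir (T.map f) (S.toCluster T hN.isOrean) := by
  obtain ⟨g, k, hg, hgf, hp⟩ := h
  rw [toCluster, toCluster, ← hN.dir_ker_of_isPushout (hp.map T), ← hN.isOrean.dir_comp,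
    ← hN.isOrean.dir_comp, ← T.map_comp, ← T.map_comp, hgf]

include hd

theorem toCluster_comap [HasPullbacks C] {X Y : C} (e : X ⟶ Y) (U : Subquotient Y)
    [PreservesLimit (cospan e U.ι) T] :
    (comap e U).toCluster T hN.isOrean =
      hN.isOrean.inv (T.map e) (U.toCluster T hN.isOrean) := by
  rw [toCluster, toCluster,
    hd.inv_dir_ker_of_isPullback hN ((IsPullback.of_hasPullback e U.ι).map T), ← T.map_comp]
  rfl

theorem toCluster_ker [HasPullbacks C] {X Y : C} (e : X ⟶ Y)
    [PreservesLimit (cospan e (bot hC Y).ι) T] :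
    (ker hC e).toCluster T hN.isOrean = hN.isOrean.ker (T.map e) := by
  rw [ker, toCluster_comap T hd hN, toCluster_bot T hN]
  rfl

include hC

/-- Applying `κs` leaves a comparison of the images of the subobjects, which gives `g`; cancelling
the monomorphism `T.map U.ι` then leaves a comparison of kernels, which gives `k`. -/
theorem rel_toCluster_iff {X Y : C} {f : X ⟶ Y} {S : Subquotient X} {U : Subquotient Y} :
    P.rel (T.map f) (S.toCluster T hN.isOrean) (U.toCluster T hN.isOrean) ↔ Rel f S U := by
  refine ⟨fun h => ?_, fun h => h.toCluster T hN⟩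
  have hO := hN.isOrean
  have h1 := κs.monotone _ _ _ h
  rw [toCluster, toCluster, hd.s_dir_ker hN (S.subinitial.map T),
    hd.s_dir_ker hN (U.subinitial.map T), ← hO.dir_le_iff, ← hO.im_comp, ← T.map_comp] at h1
  obtain ⟨t, ht⟩ := hN.exists_comp_eq_of_im_le _ _ h1
  obtain ⟨g, hg⟩ := exists_comp_eq_of_map_mono T hC ht
  rw [toCluster, toCluster, ← hO.dir_le_iff, ← hO.dir_comp, ← T.map_comp, ← hg, T.map_comp,
    hO.dir_comp, hO.dir_le_iff, ← hO.le_inv_iff, hN.inv_dir_of_mono, hO.dir_le_iff,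
    ← hO.le_inv_iff, ← hO.ker_comp, ← T.map_comp] at h
  obtain ⟨s, hs⟩ := hN.exists_comp_eq_of_ker_le _ _ h
  obtain ⟨k, hk⟩ := exists_comp_eq_of_map_epi T hs
  exact ⟨g, k, hg, hk⟩

theorem toCluster_le_iff {X : C} {S U : Subquotient X} :
    S.toCluster T hN.isOrean ≤ U.toCluster T hN.isOrean ↔ Rel (𝟙 X) S U := by
  rw [← rel_toCluster_iff T hd hN hC, T.map_id]
  rfl

theorem isNoetherian_of_functor [HasTerminal C] [HasPullbacks C]
    [PreservesLimit (Functor.empty.{0} C) T]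
    (hT : ∀ {X Y Z : C} (e : X ⟶ Z) (f : Y ⟶ Z), Epi e → PreservesLimit (cospan e f) T) :
    IsNoetherian hC where
  subinitial_terminal := by
    -- Every morphism into a terminal object of `C'` is epi, and `T` reflects epimorphisms; so the
    -- terminal object of `C` is a quotient of the initial one.
    have h1 := hd.epi_of_isTerminal hN (terminalIsTerminal.isTerminalObj T (⊤_ C))
      (T.map (initial.to (⊤_ C)))
    have h2 : Epi (initial.to (⊤_ C)) := T.epi_of_epi_map h1
    exact (Subinitial.of_isInitial initialIsInitial).of_epi (initial.to (⊤_ C))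
  exists_comp_eq := by
    intro X Y Z e f he h
    have := hT e (bot hC Y).ι he
    -- As `f` need not be epi, `T` may fail to preserve the pullback defining its kernel; the
    -- inclusion into `Ker (T.map f)` suffices.
    have h1 := (rel_comap f (bot hC Z)).toCluster T hN
    rw [toCluster_bot T hN, ← hN.isOrean.le_inv_iff] at h1
    have h2 := ((toCluster_le_iff T hd hN hC).2 h).trans h1
    rw [toCluster_ker T hd hN hC] at h2
    obtain ⟨t, ht⟩ := hN.exists_comp_eq_of_ker_le _ _ h2
    exact exists_comp_eq_of_map_epi T ht
  comap_map := by
    intro X Y e S U V he hV hS hK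
    have := hT e (bot hC Y).ι he
    have := hT e V.ι he
    rw [← toCluster_le_iff T hd hN hC] at hS hK ⊢
    rw [toCluster_ker T hd hN hC] at hK
    rw [toCluster_comap T hd hN, toCluster_of_isMap T hN hV]
    refine (hN.isLUB_inv_dir _ _).2 ?_
    rintro W (rfl | rfl)
    exacts [hS, hK]
  map_comap := by
    intro X Y e V W he h
    have := hT e V.ι he
    rw [← rel_toCluster_iff T hd hN hC, toCluster_comap T hd hN, ← hN.isOrean.dir_le_iff,
      hN.dir_inv_of_epi] at h
    exact (toCluster_le_iff T hd hN hC).1 h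
  ker_pushout := by
    intro X Y Z W x y x' y' U hx hy hp h1 h2
    have := hT x (bot hC Y).ι hx
    have := hT y (bot hC Z).ι hy
    -- Needed for `x ≫ x'` to be epi, so that `T` preserves the pullback defining its kernel.
    have hx' : Epi x' := ⟨fun u v huv => hp.hom_ext huv (by
      rw [← cancel_epi y, ← hp.w_assoc, ← hp.w_assoc, huv])⟩
    have := hT (x ≫ x') (bot hC W).ι inferInstance
    rw [← toCluster_le_iff T hd hN hC, toCluster_ker T hd hN hC] at h1 h2 ⊢
    rw [T.map_comp]
    refine (hN.isLUB_ker_of_isPushout (hp.map T)).2 ?_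
    rintro V (rfl | rfl)
    exacts [h1, h2]
  mono_pushout := by
    intro A X Q Y a q x y hQ ha hp
    exact T.mono_of_mono_map (hd.mono_of_isPushout hN (hQ.map T) (hp.map T))

end Subquotient

end Transfer

end FormTheory

/-! ### The transferred form. -/

theorem mainTheorem12
    {C : Type u₁} [CategoryTheory.Category.{v₁} C] {C' : Type u₂} [CategoryTheory.Category.{v₂} C']
    (E M : CategoryTheory.MorphismProperty C) (E' M' : CategoryTheory.MorphismProperty C')
    (hC : FormTheory.IsBalancedOreanBicategory E M)
    (hC' : FormTheory.IsBalancedOreanBicategory E' M')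
    (hColim : CategoryTheory.Limits.HasFiniteColimits C)
    (hTerm : CategoryTheory.Limits.HasTerminal C)
    (hPull : CategoryTheory.Limits.HasPullbacks C)
    (T : CategoryTheory.Functor C C')
    (hFaithful : T.Faithful)
    (hTColim : CategoryTheory.Limits.PreservesFiniteColimits T)
    (hTTerm : CategoryTheory.Limits.PreservesLimit (CategoryTheory.Functor.empty.{0} C) T)
    (hTMono : T.PreservesMonomorphisms)
    (hTPull : ∀ {X Y Z : C} (e : X ⟶ Z) (f : Y ⟶ Z), CategoryTheory.Epi e →
      CategoryTheory.Limits.PreservesLimit (CategoryTheory.Limits.cospan e f) T)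
    (hForm : FormTheory.HasEmdNoetherianForm.{w} C') :
    FormTheory.HasEmdNoetherianForm.{w} C := by
  have := hC.balanced
  have := hC'.balanced
  have hfac := hC.isOrean.isProperFactorizationSystem.epiMonoFactorizations
  obtain ⟨B, _, F, hF, hsmall, hN, κs, κe, hd⟩ := hForm
  have : ∀ X', Small.{w} (hF.clusters.Cluster X') := hsmall
  refine FormTheory.hasEmdNoetherianForm_of_represents
    (FormTheory.Subquotient.isNoetherian_of_functor T hd hN hfac hTPull)
    -- Realizing subquotients up to isomorphism as actual clusters of the small form on `C'` keeps
    -- the sets of clusters in the universe `w`.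
    (P := hF.clusters.restrict T fun X s =>
      ∃ S : FormTheory.Subquotient X, S.toCluster T hN.isOrean = s)
    (mk := fun X S => ⟨equivShrink _ (S.toCluster T hN.isOrean), S, by simp⟩) ⟨?_, ?_⟩
  · rintro X ⟨s, S, hS⟩
    exact ⟨S, Subtype.ext (by simp [hS])⟩
  · intro X Y f S U
    rw [← FormTheory.Subquotient.rel_toCluster_iff T hd hN hfac]
    simp [FormTheory.ClusterSystem.restrict]
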